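/- Let $\mathfrak g$ be a split real semisimple Lie algebra with Killing form $\langle\cdot,\cdot\rangle$, let $\mathfrak a$ be a split Cartan subalgebra with root system $\Pi$, root spaces $\mathfrak g_\alpha$, positive roots $\Pi^+$ and simple roots $\Sigma$, and let $\Theta\subseteq\Sigma$. Write $\langle\Theta\rangle^{\pm}$ for the positive/negative roots generated by $\Theta$, and set $$\mathfrak p_\Theta=\mathfrak a\oplus\sum_{\alpha\in\Pi^+}\mathfrak g_\alpha\oplus\sum_{\alpha\in\langle\Theta\rangle^-}\mathfrak g_\alpha,\qquad \mathfrak n_\Theta^{-}=\sum_{\alpha\in\Pi^-\setminus\langle\Theta\rangle^-}\mathfrak g_\alpha,\qquad \mathfrak n_\Theta^{+}=\sum_{\alpha\in\Pi^-\setminus\langle\Theta\rangle^-}\mathfrak g_{-\alpha}.$$ Let $G$ be the group of inner automorphisms of $\mathfrak g$, $P_\Theta$ the normalizer of $\mathfrak p_\Theta$ in $G$, $\mathbb F_\Theta=G/P_\Theta$ the flag manifold, $b_\Theta$ its origin, and $N_\Theta^-\subset G$ the connected subgroup with Lie algebra $\mathfrak n_\Theta^-$. The map $X\mapsto\frac{d}{dt}\big|_{0}e^{t\,\mathrm{ad}X}b_\Theta$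 identifies $\mathfrak n_\Theta^-$ with $T_{b_\Theta}\mathbb F_\Theta$, and $Z\mapsto\langle Z,\cdot\rangle|_{\mathfrak n_\Theta^-}$ identifies $\mathfrak n_\Theta^+$ with $T^*_{b_\Theta}\mathbb F_\Theta$. The orbit $N_\Theta^-b_\Theta$ is an open neighbourhood of $b_\Theta$ on which $N_\Theta^-$ acts freely. For $X\in\mathfrak n_\Theta^-$ and $Z^*\in(\mathfrak n_\Theta^-)^*$, represented by $Z^-\in\mathfrak n_\Theta^+$ through $Z^*=\langle Z^-,\cdot\rangle$, denote also by $X+Z^*$ the smooth $N_\Theta^-$-invariant section of $T\mathbb F_\Theta\oplus T^*\mathbb F_\Theta$ over this orbit whose value at $b_\Theta$ is $X+Z^*$. Let $[X+\xi,Y+\eta]=[X,Y]+\mathcal L_X\eta-\mathcal L_Y\xi-\frac12 d(i_X\eta-i_Y\xi)$ be the Courant bracket of sections, let $\langle X+\xi,Y+\eta\rangle=\frac12(\xi(Y)+\eta(X))$ be the natural inner product of $T\mathbb F_\Theta\oplus T^*\mathbb F_\Theta$, and let $\mathrm{Nij}(A,B,C)=\frac13\big(\langle[A,B],C\rangle+\langle[B,C],A\rangle+\langle[C,A],B\rangle\big)$.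 Then at the origin $b_\Theta$ the Courant bracket of these sections is $$[X+Z^*,Y+W^*]=[X,Y]+\mathrm{ad}^*_XW^*-\mathrm{ad}^*_YZ^*,$$ where on the right $[X,Y]$ is the bracket of $\mathfrak n_\Theta^-$ and $\mathrm{ad}^*$ is the coadjoint representation, $\mathrm{ad}^*_X\varphi=-\varphi\circ\mathrm{ad}_X$ (restricted to $\mathfrak n_\Theta^-$), and the Nijenhuis operator is $$\mathrm{Nij}(A_1+A_2^*,B_1+B_2^*,C_1+C_2^*)=\tfrac12\big(\langle A_2^-,[B_1,C_1]\rangle+\langle B_2^-,[C_1,A_1]\rangle+\langle C_2^-,[A_1,B_1]\rangle\big)$$ (Killing form on the right), for all $X,Y,A_1,B_1,C_1\in\mathfrak n_\Theta^-$ and $Z^*,W^*,A_2^*,B_2^*,C_2^*\in(\mathfrak n_\Theta^-)^*$. -/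

import Mathlib

open scoped Manifold ContDiff Topology

namespace RealFlag

noncomputable section

section Inner

variable (g : Type*) [LieRing g] [LieAlgebra ℝ g] [FiniteDimensional ℝ g]

/-- The norm on a finite-dimensional real Lie algebra induced by coordinates in a basis. All norms
are equivalent, so the choice plays no role; the priority is low so that it is used only for Lie
algebras that carry no norm of their own. -/
instance (priority := 10) normedAddCommGroupLie : NormedAddCommGroup g :=
  NormedAddCommGroup.induced g (Fin (Module.finrank ℝ g) → ℝ)
    (Module.finBasis ℝ g).equivFun (Module.finBasis ℝ g).equivFun.injective

instance (priority := 10) normedSpaceLie : NormedSpace ℝ g :=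
  NormedSpace.induced ℝ g (Fin (Module.finrank ℝ g) → ℝ) (Module.finBasis ℝ g).equivFun.toLinearMap

variable {g}
/-- The adjoint operator `ad X`, as a continuous linear map. -/
def adL (X : g) : g →L[ℝ] g := LinearMap.toContinuousLinearMap (LieAlgebra.ad ℝ g X)

@[simp] lemma adL_apply (X x : g) : adL X x = ⁅X, x⁆ := rfl

/-- `e ^ (ad X)` as an element of `GL(g)`. -/
def expAdUnit (X : g) : (g →L[ℝ] g)ˣ where
  val := NormedSpace.exp (adL X)
  inv := NormedSpace.exp (-adL X)
  val_inv := by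
    let := NormedAlgebra.restrictScalars ℚ ℝ (g →L[ℝ] g)
    rw [← NormedSpace.exp_add_of_commute (Commute.neg_right (Commute.refl (adL X))), add_neg_cancel,
      NormedSpace.exp_zero]
  inv_val := by
    let := NormedAlgebra.restrictScalars ℚ ℝ (g →L[ℝ] g)
    rw [← NormedSpace.exp_add_of_commute (Commute.neg_left (Commute.refl (adL X))), neg_add_cancel,
      NormedSpace.exp_zero]

variable (g) in
/-- The group of inner automorphisms of `g`: the subgroup of `GL(g)` generated by all
`e ^ (ad X)`. -/
def Inn : Subgroup (g →L[ℝ] g)ˣ := Subgroup.closure (Set.range (expAdUnit (g := g)))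

/-- `e ^ (ad X)` as an inner automorphism. -/
def expAd (X : g) : Inn g := ⟨expAdUnit X, Subgroup.subset_closure ⟨X, rfl⟩⟩

/-- The underlying linear map of an inner automorphism. -/
def act (u : Inn g) : g →L[ℝ] g := ((u : (g →L[ℝ] g)ˣ) : g →L[ℝ] g)

lemma act_expAd (X : g) : act (expAd X) = NormedSpace.exp (adL X) := rfl
lemma act_mul (u v : Inn g) (x : g) : act (u * v) x = act u (act v x) := rfl
lemma act_one (x : g) : act (1 : Inn g) x = x := rfl
lemma act_inv_act (u : Inn g) (x : g) : act u⁻¹ (act u x) = x := by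
  rw [← act_mul, inv_mul_cancel, act_one]
lemma act_act_inv (u : Inn g) (x : g) : act u (act u⁻¹ x) = x := by
  rw [← act_mul, mul_inv_cancel, act_one]

lemma act_injective (u : Inn g) : Function.Injective (act u) :=
  Function.LeftInverse.injective (act_inv_act u)

lemma exp_adL_lie (X x y : g) : NormedSpace.exp (adL X) ⁅x, y⁆ =
    ⁅NormedSpace.exp (adL X) x, NormedSpace.exp (adL X) y⁆ := by
  let L : g →ₗ[ℝ] g →ₗ[ℝ] g := (LieModule.toEnd ℝ g g : g →ₗ[ℝ] Module.End ℝ g)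
  let Lc : g →L[ℝ] g →L[ℝ] g := LinearMap.toContinuousLinearMap
    ((LinearMap.toContinuousLinearMap : (g →ₗ[ℝ] g) ≃ₗ[ℝ] (g →L[ℝ] g)).toLinearMap ∘ₗ L)
  have hLc : ∀ a b, Lc a b = ⁅a, b⁆ := fun a b => rfl
  let T := adL X
  have hT : ∀ a b, T ⁅a, b⁆ = ⁅T a, b⁆ + ⁅a, T b⁆ := fun a b => by
    simp only [T, adL_apply]; exact leibniz_lie X a b
  let E : ℝ → (g →L[ℝ] g) := fun t => NormedSpace.exp (t • T)
  have hE : ∀ t, HasDerivAt E (E t * T) t := fun t => hasDerivAt_exp_smul_const T t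
  have hE' : ∀ t, HasDerivAt E (T * E t) t := fun t => hasDerivAt_exp_smul_const' T t
  have hcomm : ∀ t a, T (E t a) = E t (T a) := fun t a => by
    have := (hE t).unique (hE' t)
    exact (congrArg (fun f : g →L[ℝ] g => f a) this).symm
  have hEn : ∀ t, HasDerivAt (fun s => E (-s)) (-(E (-t) * T)) t := fun t => by
    have := (hE (-t)).scomp t (hasDerivAt_neg t)
    rw [neg_smul, one_smul] at this
    exact this
  let f : ℝ → g := fun t => E (-t) (Lc (E t x) (E t y))
  have hf : ∀ t, HasDerivAt f 0 t := by
    intro t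
    have h1 : HasDerivAt (fun s => E s x) (T (E t x)) t := by
      simpa using (hE' t).clm_apply (hasDerivAt_const t x)
    have h2 : HasDerivAt (fun s => E s y) (T (E t y)) t := by
      simpa using (hE' t).clm_apply (hasDerivAt_const t y)
    have h3 := (Lc.hasFDerivAt.comp_hasDerivAt t h1).clm_apply h2
    have h4 := (hEn t).clm_apply h3
    have e0 : (0 : g) = -E (-t) (T ⁅E t x, E t y⁆) +
        E (-t) (⁅T (E t x), E t y⁆ + ⁅E t x, T (E t y)⁆) := by
      rw [hT, neg_add_cancel]
    rw [e0]
    exact h4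
  have hc : f 1 = f 0 := is_const_of_deriv_eq_zero (fun t => (hf t).differentiableAt)
    (fun t => (hf t).deriv) 1 0
  have h0 : E 0 = 1 := by simp [E, NormedSpace.exp_zero]
  have h1 : E 1 = NormedSpace.exp T := by simp [E]
  have hinv : E 1 * E (-1) = 1 := by
    simp only [E, neg_smul, one_smul]
    exact (expAdUnit X).val_inv
  have : E 1 (f 1) = E 1 (f 0) := by rw [hc]
  simp only [f, neg_zero, h0, hLc, one_apply_eq_self] at this
  rw [← mul_apply_eq_comp, hinv, one_apply_eq_self] at this
  rw [h1] at this
  exact this.symm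

lemma act_lie (u : Inn g) (x y : g) : act u ⁅x, y⁆ = ⁅act u x, act u y⁆ := by
  obtain ⟨u, hu⟩ := u
  change (u : g →L[ℝ] g) ⁅x, y⁆ = ⁅(u : g →L[ℝ] g) x, (u : g →L[ℝ] g) y⁆
  induction hu using Subgroup.closure_induction generalizing x y with
  | mem u hu => obtain ⟨X, rfl⟩ := hu; exact exp_adL_lie X x y
  | one => rfl
  | mul u v _ _ hu hv =>
    simp only [Units.val_mul, mul_apply_eq_comp]
    rw [hv, hu]
  | inv u _ hu =>
    have h1 : ∀ z, (u : g →L[ℝ] g) (((u⁻¹ : (g →L[ℝ] g)ˣ) : g →L[ℝ] g) z) = z := fun z => by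
      rw [← mul_apply_eq_comp, Units.mul_inv]; rfl
    have h2 : ∀ z, ((u⁻¹ : (g →L[ℝ] g)ˣ) : g →L[ℝ] g) ((u : g →L[ℝ] g) z) = z := fun z => by
      rw [← mul_apply_eq_comp, Units.inv_mul]; rfl
    conv_lhs => rw [← h1 x, ← h1 y, ← hu, h2]

end Inner

section Grading

variable {g : Type*} [LieRing g] [LieAlgebra ℝ g] [FiniteDimensional ℝ g]

/-- The eigenspaces of `ad D`. -/
abbrev eig (D : g) (c : ℝ) : Submodule ℝ g := Module.End.eigenspace (LieAlgebra.ad ℝ g D) c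

lemma mem_eig {D : g} {c : ℝ} {x : g} : x ∈ eig D c ↔ ⁅D, x⁆ = c • x := by
  rw [Module.End.mem_eigenspace_iff, LieAlgebra.ad_apply]

/-- `D` grades `g` by integers, with nonnegative part `p` and negative part `n`. -/
structure IsGrading (D : g) (p n : Submodule ℝ g) : Prop where
  p_le : p ≤ ⨆ k : ℕ, eig D (k : ℝ)
  n_le : n ≤ ⨆ k : ℕ, eig D (-((k : ℝ) + 1))
  top : p ⊔ n = ⊤

namespace IsGrading

variable {D : g} {p n : Submodule ℝ g}

lemma disj (D : g) :
    Disjoint (⨆ k : ℕ, eig D (k : ℝ)) (⨆ k : ℕ, eig D (-((k : ℝ) + 1))) := by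
  have h := (Module.End.eigenspaces_iSupIndep (LieAlgebra.ad ℝ g D)).disjoint_biSup_biSup
    (s := Set.range fun k : ℕ => (k : ℝ)) (t := Set.range fun k : ℕ => -((k : ℝ) + 1)) (by
      rw [Set.disjoint_left]
      rintro _ ⟨a, rfl⟩ ⟨b, hb⟩
      have : (0 : ℝ) ≤ a := a.cast_nonneg
      have : (0 : ℝ) ≤ b := b.cast_nonneg
      simp only at hb
      linarith)
  simpa only [iSup_range] using h

lemma isCompl (h : IsGrading D p n) : IsCompl p n :=
  ⟨(disj D).mono h.p_le h.n_le, codisjoint_iff.2 h.top⟩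

lemma p_eq (h : IsGrading D p n) : p = ⨆ k : ℕ, eig D (k : ℝ) := by
  refine le_antisymm h.p_le ?_
  have h1 : IsCompl (⨆ k : ℕ, eig D (k : ℝ)) n :=
    ⟨(disj D).mono_right h.n_le, codisjoint_iff.2 (eq_top_iff.2 (h.top ▸ sup_le_sup_right h.p_le n))⟩
  exact (eq_of_le_of_inf_le_of_sup_le h.p_le (by rw [h1.inf_eq_bot]; exact bot_le)
    (by rw [h.top]; exact le_top)).ge

lemma n_eq (h : IsGrading D p n) : n = ⨆ k : ℕ, eig D (-((k : ℝ) + 1)) := by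
  have h1 : IsCompl p (⨆ k : ℕ, eig D (-((k : ℝ) + 1))) :=
    ⟨(disj D).mono_left h.p_le, codisjoint_iff.2 (eq_top_iff.2 (h.top ▸ sup_le_sup_left h.n_le p))⟩
  exact eq_of_le_of_inf_le_of_sup_le h.n_le
    (by rw [inf_comm, h1.inf_eq_bot]; exact bot_le) (by rw [sup_comm n, h.top]; exact le_top)

lemma eig_le_p (h : IsGrading D p n) (k : ℕ) : eig D (k : ℝ) ≤ p := by
  rw [h.p_eq]; exact le_iSup (fun k : ℕ => eig D (k : ℝ)) k

lemma eig_le_n (h : IsGrading D p n) (k : ℕ) : eig D (-((k : ℝ) + 1)) ≤ n := by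
  rw [h.n_eq]; exact le_iSup (fun k : ℕ => eig D (-((k : ℝ) + 1))) k

lemma D_mem (h : IsGrading D p n) : D ∈ p := h.eig_le_p 0 (mem_eig.2 (by simp))

lemma iSup_eig (h : IsGrading D p n) : ⨆ c : ℝ, eig D c = ⊤ := by
  rw [eq_top_iff, ← h.top, h.p_eq, h.n_eq]
  exact sup_le (iSup_le fun k => le_iSup (eig D) _) (iSup_le fun k => le_iSup (eig D) _)

lemma eig_cases (h : IsGrading D p n) (c : ℝ) : eig D c ≤ p ∨ eig D c ≤ n := by
  by_cases h1 : ∃ k : ℕ, c = k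
  · obtain ⟨k, rfl⟩ := h1; exact Or.inl (h.eig_le_p k)
  by_cases h2 : ∃ k : ℕ, c = -((k : ℝ) + 1)
  · obtain ⟨k, rfl⟩ := h2; exact Or.inr (h.eig_le_n k)
  left
  have h3 := Module.End.eigenspaces_iSupIndep (LieAlgebra.ad ℝ g D) c
  have h4 : (⨆ d, ⨆ (_ : d ≠ c), eig D d) = ⊤ := by
    rw [eq_top_iff, ← h.top, h.p_eq, h.n_eq]
    refine sup_le (iSup_le fun k => ?_) (iSup_le fun k => ?_)
    · exact le_iSup₂_of_le (k : ℝ) (fun e => h1 ⟨k, e.symm⟩) le_rfl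
    · exact le_iSup₂_of_le (-((k : ℝ) + 1)) (fun e => h2 ⟨k, e.symm⟩) le_rfl
  have h5 : eig D c = ⊥ := by
    have := h3.eq_bot_of_le (by exact le_top.trans h4.ge)
    exact this
  rw [h5]; exact bot_le

/-- A complement of `n` containing `D` and stable under `ad D` lies in `p`. -/
lemma le_p (h : IsGrading D p n) {q : Submodule ℝ g} (hq : ∀ x ∈ q, ⁅D, x⁆ ∈ q) (hqn : q ⊓ n = ⊥) : q ≤ p := by
  have h1 : q ⊓ ⨆ c, (LieAlgebra.ad ℝ g D).genEigenspace c 1 =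
      ⨆ c, q ⊓ (LieAlgebra.ad ℝ g D).genEigenspace c 1 :=
    Submodule.inf_iSup_genEigenspace hq 1
  have h2 : (⨆ c, (LieAlgebra.ad ℝ g D).genEigenspace c 1) = ⊤ := h.iSup_eig
  rw [h2, inf_top_eq] at h1
  rw [h1]
  refine iSup_le fun c => ?_
  rcases h.eig_cases c with hc | hc
  · exact inf_le_right.trans hc
  · have : q ⊓ (LieAlgebra.ad ℝ g D).genEigenspace c 1 ≤ q ⊓ n := inf_le_inf_left q hc
    rw [hqn] at this
    exact this.trans bot_le

/-- The part of degree at most `-k`. -/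
def fil (D : g) (k : ℕ) : Submodule ℝ g := ⨆ j : ℕ, eig D (-((k : ℝ) + j))

lemma eig_le_fil {k j : ℕ} (hkj : k ≤ j) : eig D (-(j : ℝ)) ≤ fil D k := by
  obtain ⟨i, rfl⟩ := Nat.exists_eq_add_of_le hkj
  refine le_trans (le_of_eq ?_) (le_iSup (fun j : ℕ => eig D (-((k : ℝ) + j))) i)
  push_cast; rfl

lemma fil_anti {k l : ℕ} (hkl : k ≤ l) : fil D l ≤ fil D k := by
  refine iSup_le fun j => ?_
  have := eig_le_fil (D := D) (k := k) (j := l + j) (by omega)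
  push_cast at this
  exact this

lemma lie_mem_eig {a b : ℝ} {x y : g} (hx : x ∈ eig D a) (hy : y ∈ eig D b) :
    ⁅x, y⁆ ∈ eig D (a + b) := by
  rw [mem_eig] at *
  rw [leibniz_lie, hx, hy, smul_lie, lie_smul, add_smul]

lemma lie_mem_fil {k l : ℕ} {x y : g} (hx : x ∈ fil D k) (hy : y ∈ fil D l) :
    ⁅x, y⁆ ∈ fil D (k + l) := by
  unfold fil at hx
  induction hx using Submodule.iSup_induction' with
  | zero => simp
  | add a b _ _ ha hb => rw [add_lie]; exact add_mem ha hb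
  | mem i x hx =>
    unfold fil at hy
    induction hy using Submodule.iSup_induction' with
    | zero => simp
    | add a b _ _ ha hb => rw [lie_add]; exact add_mem ha hb
    | mem j y hy =>
      have h1 := lie_mem_eig hx hy
      have h2 := eig_le_fil (D := D) (k := k + l) (j := k + i + (l + j)) (by omega)
      apply h2
      push_cast
      convert h1 using 2
      ring

lemma fil_one (h : IsGrading D p n) : fil D 1 = n := by
  rw [h.n_eq]; unfold fil
  congr 1; ext1 k; congr 1; push_cast; ring

lemma exists_bound (D : g) : ∃ m : ℕ, ∀ k : ℕ, m < k → eig D (-(k : ℝ)) = ⊥ := by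
  have hf := Module.End.finite_hasEigenvalue (LieAlgebra.ad ℝ g D)
  obtain ⟨b, hb⟩ := hf.bddBelow
  obtain ⟨m, hm⟩ := exists_nat_gt (-b)
  refine ⟨m, fun k hk => ?_⟩
  by_contra hne
  have h1 := hb (show (-(k : ℝ)) ∈ {μ | (LieAlgebra.ad ℝ g D).HasEigenvalue μ} from
    Module.End.hasEigenvalue_iff.2 hne)
  have h2 : (m : ℝ) < k := by exact_mod_cast hk
  linarith

lemma fil_eq_bot {m : ℕ} (hm : ∀ k : ℕ, m < k → eig D (-(k : ℝ)) = ⊥) : fil D (m + 1) = ⊥ := by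
  rw [eq_bot_iff]
  refine iSup_le fun j => ?_
  rw [← hm (m + 1 + j) (by omega)]
  push_cast; exact le_rfl

lemma exp_mem {T : g →L[ℝ] g} {V : Submodule ℝ g} (hV : ∀ x ∈ V, T x ∈ V) {x : g} (hx : x ∈ V) :
    NormedSpace.exp T x ∈ V := by
  have h1 := (NormedSpace.exp_series_hasSum_exp' (𝕂 := ℝ) T).mapL (ContinuousLinearMap.apply ℝ g x)
  have hc : IsClosed (V : Set g) := V.closed_of_finiteDimensional
  refine hc.mem_of_tendsto h1 (Filter.Eventually.of_forall fun s => sum_mem fun i _ => ?_)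
  have hi : ∀ i : ℕ, (T ^ i) x ∈ V := fun i => by
    induction i with
    | zero => simpa using hx
    | succ i ih => rw [pow_succ', mul_apply_eq_comp]; exact hV _ ih
  exact V.smul_mem _ (hi i)

lemma exp_sub_mem {T : g →L[ℝ] g} {V : Submodule ℝ g} (hV : ∀ x ∈ V, T x ∈ V) {x : g}
    (hx : T (T x) ∈ V) : NormedSpace.exp T x - x - T x ∈ V := by
  have h1 := (NormedSpace.exp_series_hasSum_exp' (𝕂 := ℝ) T).mapL (ContinuousLinearMap.apply ℝ g x)
  rw [← hasSum_nat_add_iff' 2] at h1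
  have hc : IsClosed (V : Set g) := V.closed_of_finiteDimensional
  have h2 := hc.mem_of_tendsto h1 (Filter.Eventually.of_forall fun s => sum_mem fun i _ => by
    have hi : ∀ i : ℕ, (T ^ (i + 2)) x ∈ V := fun i => by
      induction i with
      | zero => simpa [pow_succ] using hx
      | succ i ih =>
        rw [show i + 1 + 2 = (i + 2) + 1 from rfl, pow_succ', mul_apply_eq_comp]
        exact hV _ ih
    exact V.smul_mem _ (hi i))
  convert h2 using 1
  simp [Finset.sum_range_succ, sub_sub]

/-- Every element of `D + n` is conjugate to `D` by an inner automorphism preserving `n`. -/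
lemma exists_conj (h : IsGrading D p n) (Z : g) (hZ : Z ∈ n) :
    ∃ u : Inn g, act u D = D + Z ∧ ∀ x, act u x ∈ n ↔ x ∈ n := by
  obtain ⟨m, hm⟩ := exists_bound D
  suffices H : ∀ j k : ℕ, 1 ≤ k → k + j = m + 1 → ∀ Z ∈ fil D k,
      ∃ u : Inn g, act u D = D + Z ∧ ∀ x, act u x ∈ n ↔ x ∈ n by
    exact H m 1 le_rfl (by omega) Z (h.fil_one ▸ hZ)
  intro j
  induction j with
  | zero =>
    intro k hk hkm Z hZ
    obtain rfl : k = m + 1 := by omega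
    rw [fil_eq_bot hm, Submodule.mem_bot] at hZ
    exact ⟨1, by simp [hZ, act_one], fun x => by rw [act_one]⟩
  | succ j ih =>
    intro k hk hkm Z hZ
    have hsplit : fil D k ≤ eig D (-(k : ℝ)) ⊔ fil D (k + 1) := by
      refine iSup_le fun i => ?_
      rcases i with _ | i
      · refine le_sup_of_le_left ?_
        simp
      · refine le_sup_of_le_right (le_trans (le_of_eq ?_)
          (eig_le_fil (D := D) (k := k + 1) (j := k + (i + 1)) (by omega)))
        push_cast; rfl
    obtain ⟨A, hA, B, hB, rfl⟩ := Submodule.mem_sup.1 (hsplit hZ)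
    have hk0 : (k : ℝ) ≠ 0 := by positivity
    set W : g := (-(k : ℝ)⁻¹) • A with hW
    have hWe : W ∈ eig D (-(k : ℝ)) := Submodule.smul_mem _ _ hA
    have hWf : W ∈ fil D k := eig_le_fil le_rfl hWe
    have hWD : ⁅W, D⁆ = -A := by
      rw [← lie_skew, mem_eig.1 hWe, hW, smul_smul]
      simp [hk0]
    have hWn : ∀ l, ∀ x ∈ fil D l, ⁅W, x⁆ ∈ fil D l := fun l x hx =>
      fil_anti (by omega) (lie_mem_fil hWf hx)
    have hWn' : ∀ l, ∀ x ∈ fil D l, ⁅W, x⁆ ∈ fil D (l + 1) := fun l x hx =>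
      fil_anti (by omega) (lie_mem_fil hWf hx)
    have hAf : A ∈ fil D k := eig_le_fil le_rfl hA
    have hAB : A + B ∈ fil D k := hZ
    have h1 := exp_sub_mem (T := adL W) (V := fil D (k + 1)) (fun x hx => hWn _ x hx)
      (x := D + (A + B)) (by
        simp only [adL_apply]
        rw [lie_add W D, lie_add, hWD, lie_neg]
        exact add_mem (neg_mem (hWn' k A hAf)) (hWn _ _ (hWn' k _ hAB)))
    set B' := act (expAd W) (D + (A + B)) - D with hB'
    have h2 : B' ∈ fil D (k + 1) := by
      have : B' = (NormedSpace.exp (adL W) (D + (A + B)) - (D + (A + B)) - adL W (D + (A + B)))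
          + (B + ⁅W, A + B⁆) := by
        rw [hB', act_expAd, adL_apply, lie_add W D, hWD]; abel
      rw [this]
      exact add_mem h1 (add_mem hB (hWn' k _ hAB))
    obtain ⟨u, hu, hun⟩ := ih (k + 1) (by omega) (by omega) B' h2
    have hpres : ∀ W' : g, W' ∈ fil D k → ∀ x ∈ n, act (expAd W') x ∈ n := fun W' hW' x hx => by
      rw [act_expAd]
      refine exp_mem (fun y hy => ?_) hx
      rw [← h.fil_one] at hy ⊢
      exact fil_anti (by omega) (lie_mem_fil hW' hy)
    have hinv : ∀ x, act (expAd W)⁻¹ x = act (expAd (-W)) x := fun x => by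
      rw [act_expAd]
      have : adL (-W) = -adL W := by ext; simp
      rw [this]; rfl
    have hiff : ∀ x, act (expAd W)⁻¹ x ∈ n ↔ x ∈ n := fun x => by
      refine ⟨fun hx => ?_, fun hx => ?_⟩
      · have := hpres W hWf _ hx
        rwa [act_act_inv] at this
      · rw [hinv]
        exact hpres _ (neg_mem hWf) x hx
    refine ⟨(expAd W)⁻¹ * u, ?_, fun x => ?_⟩
    · rw [act_mul, hu]
      have : D + B' = act (expAd W) (D + (A + B)) := by rw [hB']; abel
      rw [this, act_inv_act]
    · rw [act_mul, hiff, hun]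

end IsGrading

end Grading

section Homogeneous

variable {g : Type*} [LieRing g] [LieAlgebra ℝ g] [FiniteDimensional ℝ g]

/-- The normalizer of the subspace `p` in the group of inner automorphisms. -/
def normalizer (p : Submodule ℝ g) : Subgroup (Inn g) where
  carrier := {u | p.map (act u : g →ₗ[ℝ] g) = p}
  one_mem' := by
    ext x; simp [act_one]
  mul_mem' := by
    intro a b ha hb
    have : (act (a * b) : g →ₗ[ℝ] g) = (act a : g →ₗ[ℝ] g) ∘ₗ (act b : g →ₗ[ℝ] g) := rfl
    simp only [Set.mem_ofPred_eq] at *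
    rw [this, Submodule.map_comp, hb, ha]
  inv_mem' := by
    intro a ha
    simp only [Set.mem_ofPred_eq] at *
    conv_lhs => rw [← ha]
    rw [← Submodule.map_comp]
    ext x; simp [act_inv_act]

/-- The homogeneous space `Inn(g) / N(p)`. -/
def Homog (p : Submodule ℝ g) : Type _ := Inn g ⧸ normalizer p

namespace Homog

variable {p : Submodule ℝ g}

instance : MulAction (Inn g) (Homog p) :=
  inferInstanceAs (MulAction (Inn g) (Inn g ⧸ normalizer p))

/-- The coset of an inner automorphism. -/
def mk (p : Submodule ℝ g) (u : Inn g) : Homog p := (QuotientGroup.mk u : Inn g ⧸ normalizer p)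

lemma smul_mk (u v : Inn g) : u • mk p v = mk p (u * v) := rfl

lemma mk_surjective : Function.Surjective (mk p) := QuotientGroup.mk_surjective

lemma mk_eq_mk {u v : Inn g} : mk p u = mk p v ↔
    p.map (act u : g →ₗ[ℝ] g) = p.map (act v : g →ₗ[ℝ] g) := by
  refine (QuotientGroup.eq (s := normalizer p)).trans ?_
  change p.map (act (u⁻¹ * v) : g →ₗ[ℝ] g) = p ↔ _
  have h1 : (act (u⁻¹ * v) : g →ₗ[ℝ] g) = (act u⁻¹ : g →ₗ[ℝ] g) ∘ₗ (act v : g →ₗ[ℝ] g) := rfl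
  have h2 : ∀ q : Submodule ℝ g, (q.map (act u⁻¹ : g →ₗ[ℝ] g)).map (act u : g →ₗ[ℝ] g) = q := by
    intro q; rw [← Submodule.map_comp]; ext x; simp [act_act_inv]
  rw [h1, Submodule.map_comp]
  constructor
  · intro h; rw [← h2 (p.map (act v : g →ₗ[ℝ] g)), h]
  · intro h; rw [← h, ← Submodule.map_comp]; ext x; simp [act_inv_act]

/-- The conjugate of `p` attached to a point of the homogeneous space. -/
def sub (x : Homog p) : Submodule ℝ g :=
  p.map (act (Quotient.out (s := QuotientGroup.leftRel (normalizer p)) x) : g →ₗ[ℝ] g)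

lemma sub_mk (u : Inn g) : sub (mk p u) = p.map (act u : g →ₗ[ℝ] g) := by
  unfold sub
  rw [← mk_eq_mk]
  exact Quotient.out_eq (s := QuotientGroup.leftRel (normalizer p)) (mk p u)

lemma sub_injective : Function.Injective (sub (p := p)) := by
  intro x y hxy
  obtain ⟨u, rfl⟩ := mk_surjective x
  obtain ⟨v, rfl⟩ := mk_surjective y
  rw [sub_mk, sub_mk] at hxy
  exact mk_eq_mk.2 hxy

lemma sub_smul (u : Inn g) (x : Homog p) : sub (u • x) = (sub x).map (act u : g →ₗ[ℝ] g) := by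
  obtain ⟨v, rfl⟩ := mk_surjective x
  rw [smul_mk, sub_mk, sub_mk, ← Submodule.map_comp]; rfl

lemma finrank_sub (x : Homog p) : Module.finrank ℝ (sub x) = Module.finrank ℝ p := by
  obtain ⟨v, rfl⟩ := mk_surjective x
  rw [sub_mk]
  exact (Submodule.equivMapOfInjective (act v : g →ₗ[ℝ] g) (act_injective v) p).finrank_eq.symm

variable {D : g} {n : Submodule ℝ g} (h : IsGrading D p n)

/-- `p` is a Lie subalgebra. -/
lemma lie_mem_p (h : IsGrading D p n) {x y : g} (hx : x ∈ p) (hy : y ∈ p) : ⁅x, y⁆ ∈ p := by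
  rw [h.p_eq] at hx hy
  induction hx using Submodule.iSup_induction' with
  | zero => simp
  | add a b _ _ ha hb => rw [add_lie]; exact add_mem ha hb
  | mem i x hx =>
    induction hy using Submodule.iSup_induction' with
    | zero => simp
    | add a b _ _ ha hb => rw [lie_add]; exact add_mem ha hb
    | mem j y hy =>
      apply h.eig_le_p (i + j)
      push_cast
      exact IsGrading.lie_mem_eig hx hy

lemma lie_mem_n (h : IsGrading D p n) {x y : g} (hx : x ∈ n) (hy : y ∈ n) : ⁅x, y⁆ ∈ n := by
  rw [← h.fil_one] at *
  exact IsGrading.fil_anti (by omega) (IsGrading.lie_mem_fil hx hy)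

lemma lie_mem_sub (h : IsGrading D p n) {q : Homog p} {x y : g} (hx : x ∈ sub q) (hy : y ∈ sub q) :
    ⁅x, y⁆ ∈ sub q := by
  obtain ⟨u, rfl⟩ := mk_surjective q
  rw [sub_mk] at *
  obtain ⟨a, ha, rfl⟩ := hx
  obtain ⟨b, hb, rfl⟩ := hy
  exact ⟨⁅a, b⁆, lie_mem_p h ha hb, act_lie u a b⟩

lemma isCompl_sub (h : IsGrading D p n) {q : Homog p} (hq : sub q ⊓ n = ⊥) : IsCompl (sub q) n := by
  refine ⟨disjoint_iff.2 hq, codisjoint_iff.2 ?_⟩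
  apply Submodule.eq_top_of_finrank_eq
  have h1 := Submodule.finrank_sup_add_finrank_inf_eq (sub q) n
  have h2 := Submodule.finrank_sup_add_finrank_inf_eq p n
  rw [hq, finrank_bot, finrank_sub] at h1
  rw [h.isCompl.inf_eq_bot, h.isCompl.sup_eq_top, finrank_bot, finrank_top] at h2
  omega

/-- An inner automorphism preserving `n` and taking `D` to `D + Z`. -/
def conj (Z : n) : Inn g := (h.exists_conj Z Z.2).choose

lemma conj_D (Z : n) : act (conj h Z) D = D + Z := (h.exists_conj Z Z.2).choose_spec.1
lemma conj_n (Z : n) (x : g) : act (conj h Z) x ∈ n ↔ x ∈ n :=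
  (h.exists_conj Z Z.2).choose_spec.2 x

lemma sub_conj_inf (Z : n) : sub (mk p (conj h Z)) ⊓ n = ⊥ := by
  rw [eq_bot_iff, sub_mk]
  rintro _ ⟨⟨x, hx, rfl⟩, hxn⟩
  have hx' : x ∈ n := (conj_n h Z x).1 hxn
  have : x ∈ p ⊓ n := ⟨hx, hx'⟩
  rw [h.isCompl.inf_eq_bot, Submodule.mem_bot] at this
  simp [this]

lemma mem_sub_conj (Z : n) : D + (Z : g) ∈ sub (mk p (conj h Z)) := by
  rw [sub_mk]; exact ⟨D, h.D_mem, conj_D h Z⟩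

lemma eq_conj {q : Homog p} (hq : sub q ⊓ n = ⊥) {Z : n} (hZ : D + (Z : g) ∈ sub q) :
    q = mk p (conj h Z) := by
  set u := conj h Z with hu
  have hD : D ∈ sub (u⁻¹ • q) := by
    rw [sub_smul]
    exact ⟨D + Z, hZ, by rw [← conj_D h Z]; exact act_inv_act _ _⟩
  have hn : sub (u⁻¹ • q) ⊓ n = ⊥ := by
    rw [eq_bot_iff, sub_smul]
    rintro _ ⟨⟨x, hx, rfl⟩, hxn⟩
    have h1 : x ∈ n := by
      have := (conj_n h Z _).2 hxn
      rwa [← hu, ContinuousLinearMap.coe_coe, act_act_inv] at this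
    have : x ∈ sub q ⊓ n := ⟨hx, h1⟩
    rw [hq, Submodule.mem_bot] at this
    simp [this]
  have h2 : sub (u⁻¹ • q) ≤ p := h.le_p (fun x hx => lie_mem_sub h hD hx) hn
  have h3 : sub (u⁻¹ • q) = p := Submodule.eq_of_le_of_finrank_eq h2 (finrank_sub _)
  have h4 : u⁻¹ • q = mk p 1 := by
    apply sub_injective
    rw [h3, sub_mk]; ext x; simp [act_one]
  rw [inv_smul_eq_iff] at h4
  rw [h4, smul_mk, mul_one]

lemma exists_coord (h : IsGrading D p n) {q : Homog p} (hq : sub q ⊓ n = ⊥) : ∃ Z : n, D + (Z : g) ∈ sub q := by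
  have h1 : D ∈ sub q ⊔ n := by rw [(isCompl_sub h hq).sup_eq_top]; trivial
  obtain ⟨a, ha, b, hb, hab⟩ := Submodule.mem_sup.1 h1
  refine ⟨⟨-b, neg_mem hb⟩, ?_⟩
  have : D + -b = a := by rw [← hab]; abel
  simpa [this] using ha

lemma coord_unique {q : Homog p} (hq : sub q ⊓ n = ⊥) {Z Z' : n} (hZ : D + (Z : g) ∈ sub q)
    (hZ' : D + (Z' : g) ∈ sub q) : Z = Z' := by
  have h1 : (Z : g) - Z' ∈ sub q ⊓ n := by
    refine ⟨?_, sub_mem Z.2 Z'.2⟩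
    have := sub_mem hZ hZ'
    rwa [add_sub_add_left_eq_sub] at this
  rw [hq, Submodule.mem_bot, sub_eq_zero] at h1
  exact Subtype.ext h1

open Classical in
/-- The chart centred at the coset of `v`, defined on the translate by `v` of the set of conjugates
of `p` that are transversal to `n`: such a conjugate contains exactly one element of `D + n`. -/
def chart (v : Inn g) : PartialEquiv (Homog p) n where
  toFun q := if hq : sub (v⁻¹ • q) ⊓ n = ⊥ then (exists_coord h hq).choose else 0
  invFun Z := v • mk p (conj h Z)
  source := {q | sub (v⁻¹ • q) ⊓ n = ⊥}
  target := Set.univ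
  map_source' _ _ := trivial
  map_target' Z _ := by
    simp only [Set.mem_ofPred_eq, inv_smul_smul]
    exact sub_conj_inf h Z
  left_inv' q hq := by
    simp only [Set.mem_ofPred_eq] at hq
    rw [dif_pos hq, ← eq_conj h hq (exists_coord h hq).choose_spec, smul_inv_smul]
  right_inv' Z _ := by
    have hq : sub (v⁻¹ • v • mk p (conj h Z)) ⊓ n = ⊥ := by
      rw [inv_smul_smul]; exact sub_conj_inf h Z
    rw [dif_pos hq]
    refine coord_unique hq (exists_coord h hq).choose_spec ?_
    rw [inv_smul_smul]; exact mem_sub_conj h Z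

lemma chart_spec (v : Inn g) {q : Homog p} (hq : sub (v⁻¹ • q) ⊓ n = ⊥) {Z : n}
    (hZ : D + (Z : g) ∈ sub (v⁻¹ • q)) : chart h v q = Z := by
  change dite _ _ _ = _
  rw [dif_pos hq]
  exact coord_unique hq (exists_coord h hq).choose_spec hZ

/-- `(T + 1) (T + 2) ⋯ (T + m)`. -/
def rising (m : ℕ) (T : g →L[ℝ] g) : g →L[ℝ] g :=
  match m with
  | 0 => 1
  | m + 1 => rising m T * (T + ((m : ℝ) + 1) • 1)

lemma contDiff_rising (m : ℕ) : ContDiff ℝ ∞ (rising (g := g) m) := by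
  induction m with
  | zero => exact contDiff_const
  | succ m ih => exact ih.mul (contDiff_id.add contDiff_const)

lemma rising_eig (m : ℕ) {c : ℝ} {x : g} (hx : x ∈ eig D c) :
    rising m (adL D) x = (∏ k ∈ Finset.range m, (c + k + 1)) • x := by
  induction m with
  | zero => simp [rising]
  | succ m ih =>
    rw [rising, mul_apply_eq_comp]
    have : (adL D + ((m : ℝ) + 1) • (1 : g →L[ℝ] g)) x = (c + m + 1) • x := by
      change ⁅D, x⁆ + ((m : ℝ) + 1) • x = _
      rw [mem_eig.1 hx, ← add_smul, add_assoc]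
    rw [this, map_smul, ih, smul_smul, Finset.prod_range_succ, mul_comm]

lemma rising_conj (m : ℕ) (u : Inn g) (X x : g) :
    rising m (adL (act u X)) (act u x) = act u (rising m (adL X) x) := by
  induction m generalizing x with
  | zero => rfl
  | succ m ih =>
    have : (adL (act u X) + ((m : ℝ) + 1) • (1 : g →L[ℝ] g)) (act u x) =
        act u ((adL X + ((m : ℝ) + 1) • (1 : g →L[ℝ] g)) x) := by
      change ⁅act u X, act u x⁆ + ((m : ℝ) + 1) • act u x = act u (⁅X, x⁆ + ((m : ℝ) + 1) • x)
      rw [map_add, map_smul, act_lie]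
    rw [rising, rising, mul_apply_eq_comp, mul_apply_eq_comp, this, ih]

lemma rising_p (h : IsGrading D p n) (m : ℕ) : p.map (rising m (adL D) : g →ₗ[ℝ] g) = p := by
  have key : ∀ k : ℕ, ∏ j ∈ Finset.range m, ((k : ℝ) + j + 1) ≠ 0 := fun k =>
    Finset.prod_ne_zero_iff.2 fun j _ => by positivity
  apply le_antisymm
  · rintro _ ⟨x, hx, rfl⟩
    simp only [SetLike.mem_coe] at hx
    rw [h.p_eq] at hx
    induction hx using Submodule.iSup_induction' with
    | zero => simp
    | add a b _ _ ha hb => rw [map_add]; exact add_mem ha hb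
    | mem k x hx =>
      rw [ContinuousLinearMap.coe_coe, rising_eig m hx]
      exact p.smul_mem _ (h.eig_le_p k hx)
  · conv_lhs => rw [h.p_eq]
    refine iSup_le fun k x hx => ?_
    refine ⟨(∏ j ∈ Finset.range m, ((k : ℝ) + j + 1))⁻¹ • x, p.smul_mem _ (h.eig_le_p k hx), ?_⟩
    rw [ContinuousLinearMap.coe_coe, map_smul, rising_eig m hx, smul_smul,
      inv_mul_cancel₀ (key k), one_smul]

lemma rising_p_inj (h : IsGrading D p n) (m : ℕ) {x : g} (hx : x ∈ p) (h0 : rising m (adL D) x = 0) : x = 0 := by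
  let f : p →ₗ[ℝ] p := (rising m (adL D) : g →ₗ[ℝ] g).restrict
    (fun y hy => by rw [← rising_p h m]; exact ⟨y, hy, rfl⟩)
  have hf : Function.Surjective f := by
    rintro ⟨y, hy⟩
    rw [← rising_p h m] at hy
    obtain ⟨z, hz, rfl⟩ := hy
    exact ⟨⟨z, hz⟩, rfl⟩
  have h1 : f ⟨x, hx⟩ = f 0 := by
    rw [map_zero]; exact Subtype.ext h0
  exact congrArg Subtype.val (LinearMap.injective_iff_surjective.2 hf h1)

lemma rising_n (h : IsGrading D p n) {m : ℕ} (hm : ∀ k : ℕ, m < k → eig D (-(k : ℝ)) = ⊥) {x : g} (hx : x ∈ n) :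
    rising m (adL D) x = 0 := by
  rw [h.n_eq] at hx
  induction hx using Submodule.iSup_induction' with
  | zero => simp
  | add a b _ _ ha hb => rw [map_add, ha, hb, add_zero]
  | mem k x hx =>
    by_cases hk : k < m
    · rw [rising_eig m hx, Finset.prod_eq_zero (Finset.mem_range.2 hk) (by ring), zero_smul]
    · have h1 := hm (k + 1) (by omega)
      push_cast at h1
      rw [h1, Submodule.mem_bot] at hx
      rw [hx, map_zero]

/-- For the coordinate `Z`, the operator whose inverse computes transition functions. -/
def transOp (m : ℕ) (v : Inn g) (Z : n) : g →L[ℝ] g :=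
  act v * rising m (adL (D + (Z : g))) *
    LinearMap.toContinuousLinearMap (p.projection n h.isCompl) +
    LinearMap.toContinuousLinearMap (n.projection p h.isCompl.symm)

lemma contDiff_transOp (m : ℕ) (v : Inn g) : ContDiff ℝ ∞ (transOp h m v) := by
  have h1 : ContDiff ℝ ∞ fun Z : n => adL (D + (Z : g)) := by
    let L : n →ₗ[ℝ] (g →L[ℝ] g) :=
      { toFun := fun Z => adL (Z : g)
        map_add' := fun a b => by ext; simp
        map_smul' := fun c a => by ext; simp }
    have : (fun Z : n => adL (D + (Z : g))) = fun Z => adL D + LinearMap.toContinuousLinearMap L Z := by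
      ext Z x; simp [L]
    rw [this]
    exact contDiff_const.add (ContinuousLinearMap.contDiff _)
  exact ((contDiff_const.mul ((contDiff_rising m).comp h1)).mul contDiff_const).add contDiff_const

lemma transOp_apply (m : ℕ) (v : Inn g) (Z : n) (x : g) : transOp h m v Z x =
    act v (rising m (adL (D + (Z : g))) (p.projection n h.isCompl x)) +
      n.projection p h.isCompl.symm x := rfl

lemma rising_conj_mem (m : ℕ) (hm : ∀ k : ℕ, m < k → eig D (-(k : ℝ)) = ⊥) (Z : n) (x : g) :
    rising m (adL (D + (Z : g))) x ∈ sub (mk p (conj h Z)) := by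
  rw [sub_mk, ← conj_D h Z, ← act_act_inv (conj h Z) x, rising_conj]
  refine ⟨_, ?_, rfl⟩
  set y := act (conj h Z)⁻¹ x
  have hy : y ∈ p ⊔ n := by rw [h.top]; trivial
  obtain ⟨a, ha, b, hb, hab⟩ := Submodule.mem_sup.1 hy
  rw [← hab, map_add, rising_n h hm hb, add_zero]
  simp only [SetLike.mem_coe]
  rw [← rising_p h m]
  exact ⟨a, ha, rfl⟩

lemma rising_conj_inj (h : IsGrading D p n) (m : ℕ) (hm : ∀ k : ℕ, m < k → eig D (-(k : ℝ)) = ⊥) (Z : n) {x : g}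
    (hx : x ∈ p) (h0 : rising m (adL (D + (Z : g))) x = 0) : x = 0 := by
  rw [← conj_D h Z, ← act_act_inv (conj h Z) x, rising_conj] at h0
  have h1 : rising m (adL D) (act (conj h Z)⁻¹ x) = 0 :=
    act_injective (conj h Z) (by rw [h0, map_zero])
  set y := act (conj h Z)⁻¹ x with hyd
  have hy : y ∈ p ⊔ n := by rw [h.top]; trivial
  obtain ⟨a, ha, b, hb, hab⟩ := Submodule.mem_sup.1 hy
  rw [← hab, map_add, rising_n h hm hb, add_zero] at h1
  have ha0 := rising_p_inj h m ha h1
  have hyn : y ∈ n := by rw [← hab, ha0, zero_add]; exact hb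
  have hxn : x ∈ n := by
    have := (conj_n h Z y).2 hyn
    rwa [hyd, act_act_inv] at this
  have : x ∈ p ⊓ n := ⟨hx, hxn⟩
  rwa [h.isCompl.inf_eq_bot, Submodule.mem_bot] at this

lemma rising_conj_surj (m : ℕ) (hm : ∀ k : ℕ, m < k → eig D (-(k : ℝ)) = ⊥) (Z : n) {y : g}
    (hy : y ∈ sub (mk p (conj h Z))) : ∃ x ∈ p, rising m (adL (D + (Z : g))) x = y := by
  let f : p →ₗ[ℝ] sub (mk p (conj h Z)) :=
    ((rising m (adL (D + (Z : g))) : g →ₗ[ℝ] g).comp p.subtype).codRestrict _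
      (fun x => rising_conj_mem h m hm Z x)
  have hf : Function.Injective f := by
    rw [← LinearMap.ker_eq_bot, LinearMap.ker_eq_bot']
    rintro ⟨x, hx⟩ h0
    exact Subtype.ext (rising_conj_inj h m hm Z hx (congrArg Subtype.val h0))
  have hs := (LinearMap.injective_iff_surjective_of_finrank_eq_finrank
    (finrank_sub (mk p (conj h Z))).symm).1 hf
  obtain ⟨⟨x, hx⟩, hxy⟩ := hs ⟨y, hy⟩
  exact ⟨x, hx, congrArg Subtype.val hxy⟩

lemma isUnit_transOp_iff {m : ℕ} (hm : ∀ k : ℕ, m < k → eig D (-(k : ℝ)) = ⊥) (v : Inn g) (Z : n) :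
    IsUnit (transOp h m v Z) ↔ sub (v • mk p (conj h Z)) ⊓ n = ⊥ := by
  have hdec : ∀ x : g, p.projection n h.isCompl x + n.projection p h.isCompl.symm x = x := fun x =>
    Submodule.projection_add_projection_eq_self h.isCompl x
  constructor
  · intro hu
    rw [eq_bot_iff]
    rintro y ⟨hy, hyn⟩
    rw [SetLike.mem_coe, sub_smul] at hy
    obtain ⟨z, hz, hzy⟩ := hy
    obtain ⟨x, hx, rfl⟩ := rising_conj_surj h m hm Z hz
    have h1 : transOp h m v Z (x - y) = 0 := by
      have e1 : p.projection n h.isCompl (x - y) = x := by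
        rw [map_sub, Submodule.projection_apply_of_mem_left _ hx,
          Submodule.projection_apply_of_mem_right _ hyn, sub_zero]
      have e2 : n.projection p h.isCompl.symm (x - y) = -y := by
        rw [map_sub, Submodule.projection_apply_of_mem_left _ hyn,
          Submodule.projection_apply_of_mem_right _ hx, zero_sub]
      rw [transOp_apply, e1, e2, ← hzy]
      exact add_neg_cancel _
    obtain ⟨w, hw⟩ := hu
    have h2 : x - y = 0 := by
      have : ((w⁻¹ : (g →L[ℝ] g)ˣ) : g →L[ℝ] g) ((w : g →L[ℝ] g) (x - y)) = x - y := by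
        rw [← mul_apply_eq_comp, Units.inv_mul, one_apply_eq_self]
      rw [← this, hw, h1, map_zero]
    rw [sub_eq_zero] at h2
    have : x ∈ p ⊓ n := ⟨hx, h2 ▸ hyn⟩
    rw [h.isCompl.inf_eq_bot, Submodule.mem_bot] at this
    rw [Submodule.mem_bot, ← h2, this]
  · intro hq
    have hinj : Function.Injective (transOp h m v Z : g →ₗ[ℝ] g) := by
      rw [← LinearMap.ker_eq_bot, LinearMap.ker_eq_bot']
      intro x hx
      rw [ContinuousLinearMap.coe_coe, transOp_apply] at hx
      set a := p.projection n h.isCompl x with ha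
      set b := n.projection p h.isCompl.symm x with hb
      have hap : a ∈ p := Submodule.projection_apply_mem _ _
      have hbn : b ∈ n := Submodule.projection_apply_mem _ _
      have h1 : act v (rising m (adL (D + (Z : g))) a) ∈ sub (v • mk p (conj h Z)) ⊓ n := by
        refine ⟨?_, ?_⟩
        · rw [SetLike.mem_coe, sub_smul]
          exact ⟨_, rising_conj_mem h m hm Z a, rfl⟩
        · rw [eq_neg_of_add_eq_zero_left hx]; exact neg_mem hbn
      rw [hq, Submodule.mem_bot] at h1
      have h2 : a = 0 := rising_conj_inj h m hm Z hap (act_injective v (by rw [h1, map_zero]))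
      rw [h1, zero_add] at hx
      rw [← hdec x, ← ha, ← hb, h2, hx, add_zero]
    have hsurj := LinearMap.injective_iff_surjective.1 hinj
    let e : g ≃L[ℝ] g := (LinearEquiv.ofBijective _ ⟨hinj, hsurj⟩).toContinuousLinearEquiv
    exact ⟨ContinuousLinearEquiv.toUnit e, by ext x; rfl⟩

lemma chart_trans {m : ℕ} (hm : ∀ k : ℕ, m < k → eig D (-(k : ℝ)) = ⊥) (v w : Inn g) (Z : n)
    (hu : IsUnit (transOp h m (w⁻¹ * v) Z)) : ((chart h w ((chart h v).symm Z) : n) : g) =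
    -n.projection p h.isCompl.symm (Ring.inverse (transOp h m (w⁻¹ * v) Z) D) := by
  have hq := (isUnit_transOp_iff h hm (w⁻¹ * v) Z).1 hu
  obtain ⟨s, hs⟩ := hu
  set y := Ring.inverse (transOp h m (w⁻¹ * v) Z) D with hy
  have hSy : transOp h m (w⁻¹ * v) Z y = D := by
    rw [hy, ← hs, Ring.inverse_unit, ← mul_apply_eq_comp, Units.mul_inv, one_apply_eq_self]
  have hmem : n.projection p h.isCompl.symm y ∈ n := Submodule.projection_apply_mem _ _
  have hsym : (chart h v).symm Z = v • mk p (conj h Z) := rfl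
  have h1 : chart h w ((chart h v).symm Z) = ⟨-n.projection p h.isCompl.symm y, neg_mem hmem⟩ := by
    apply chart_spec
    · rw [hsym, smul_smul]; exact hq
    · rw [hsym, smul_smul, sub_smul]
      rw [transOp_apply] at hSy
      refine ⟨_, rising_conj_mem h m hm Z (p.projection n h.isCompl y), ?_⟩
      rw [ContinuousLinearMap.coe_coe, eq_sub_of_add_eq hSy, sub_eq_add_neg]
  rw [h1]

lemma trans_source {m : ℕ} (hm : ∀ k : ℕ, m < k → eig D (-(k : ℝ)) = ⊥) (v w : Inn g) :
    ((chart h v).symm.trans (chart h w)).source = {Z | IsUnit (transOp h m (w⁻¹ * v) Z)} := by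
  ext Z
  rw [PartialEquiv.trans_source]
  simp only [Set.mem_inter_iff, Set.mem_preimage, Set.mem_ofPred_eq]
  rw [isUnit_transOp_iff h hm]
  constructor
  · rintro ⟨-, h1⟩
    have h1 : sub (w⁻¹ • v • mk p (conj h Z)) ⊓ n = ⊥ := h1
    rwa [smul_smul] at h1
  · intro h1
    refine ⟨trivial, ?_⟩
    change sub (w⁻¹ • v • mk p (conj h Z)) ⊓ n = ⊥
    rwa [smul_smul]

lemma isOpen_trans_source (v w : Inn g) :
    IsOpen ((chart h v).symm.trans (chart h w)).source := by
  obtain ⟨m, hm⟩ := IsGrading.exists_bound D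
  rw [trans_source h hm]
  exact Units.isOpen.preimage (contDiff_transOp h m _).continuous

lemma contDiffOn_trans (v w : Inn g) : ContDiffOn ℝ ∞ ((chart h v).symm.trans (chart h w))
    ((chart h v).symm.trans (chart h w)).source := by
  obtain ⟨m, hm⟩ := IsGrading.exists_bound D
  rw [trans_source h hm]
  let π : g →L[ℝ] n := LinearMap.toContinuousLinearMap (n.projectionOnto p h.isCompl.symm)
  have h1 : ContDiffOn ℝ ∞
      (fun Z : n => -π (Ring.inverse (transOp h m (w⁻¹ * v) Z) D))
      {Z | IsUnit (transOp h m (w⁻¹ * v) Z)} := by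
    intro Z hZ
    obtain ⟨s, hs⟩ := hZ
    have h2 : ContDiffAt ℝ ∞ (Ring.inverse : (g →L[ℝ] g) → (g →L[ℝ] g)) (transOp h m (w⁻¹ * v) Z) := by
      rw [← hs]; exact contDiffAt_ringInverse ℝ s
    have h3 := h2.comp Z (contDiff_transOp h m (w⁻¹ * v)).contDiffAt
    exact ((π.contDiff.contDiffAt.comp Z (h3.clm_apply contDiffAt_const)).neg).contDiffWithinAt
  refine h1.congr fun Z hZ => ?_
  apply Subtype.ext
  exact chart_trans h hm v w Z hZ

/-- The atlas of `Inn(g) / N(p)` consisting of all translates of the open cell. -/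
def core : ChartedSpaceCore n (Homog p) where
  atlas := Set.range (chart h)
  chartAt q := chart h (mk_surjective q).choose
  mem_chart_source q := by
    have hv := (mk_surjective q).choose_spec
    change sub ((mk_surjective q).choose⁻¹ • q) ⊓ n = ⊥
    generalize (mk_surjective q).choose = v at hv
    rw [← hv, smul_mk, inv_mul_cancel, sub_mk]
    have : p.map (act (1 : Inn g) : g →ₗ[ℝ] g) = p := by ext x; simp [act_one]
    rw [this, h.isCompl.inf_eq_bot]
  chart_mem_atlas q := ⟨_, rfl⟩
  open_source := by
    rintro _ _ ⟨v, rfl⟩ ⟨w, rfl⟩; exact isOpen_trans_source h v w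
  continuousOn_toFun := by
    rintro _ _ ⟨v, rfl⟩ ⟨w, rfl⟩; exact (contDiffOn_trans h v w).continuousOn

lemma isManifold_core :
    letI := (core h).toTopologicalSpace
    letI := (core h).toChartedSpace
    IsManifold 𝓘(ℝ, n) ∞ (Homog p) := by
  let := (core h).toTopologicalSpace
  let := (core h).toChartedSpace
  refine isManifold_of_contDiffOn _ _ _ ?_
  intro e e' he he'
  obtain ⟨_, ⟨e1, rfl⟩, _, ⟨⟨v, rfl⟩, rfl⟩, he⟩ := he
  obtain ⟨_, ⟨e2, rfl⟩, _, ⟨⟨w, rfl⟩, rfl⟩, he'⟩ := he'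
  simp only [Set.mem_singleton_iff] at he he'
  subst he he'
  simp only [modelWithCornersSelf_coe, modelWithCornersSelf_coe_symm, Set.preimage_id,
    Set.range_id, Set.inter_univ, Function.id_comp, Function.comp_id]
  exact contDiffOn_trans h v w

end Homog
end Homogeneous

section Courant

variable (E : Type*) [NormedAddCommGroup E] [NormedSpace ℝ E]
  (M : Type*) [TopologicalSpace M] [ChartedSpace E M]

/-- A (not necessarily smooth) section `X + ξ` of `TM ⊕ T*M`. -/
structure GenField where
  /-- The vector field `X`. -/
  vec : Π x : M, TangentSpace 𝓘(ℝ, E) x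
  /-- The one-form `ξ`. -/
  form : Π x : M, TangentSpace 𝓘(ℝ, E) x →L[ℝ] ℝ

variable {E M}

/-- The Lie derivative of the one-form `η` along the vector field `V`. In coordinates,
`(L_V η)(w) = (D η (V))(w) + η (D V (w))`. -/
def lieDerivForm (V : Π x : M, TangentSpace 𝓘(ℝ, E) x)
    (η : Π x : M, TangentSpace 𝓘(ℝ, E) x →L[ℝ] ℝ) (x : M) : TangentSpace 𝓘(ℝ, E) x →L[ℝ] ℝ :=
  let e := extChartAt 𝓘(ℝ, E) x
  let V' : E → E := VectorField.mpullback 𝓘(ℝ, E) 𝓘(ℝ, E) e.symm V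
  let η' : E → E →L[ℝ] ℝ := fun y => (η (e.symm y)).comp (mfderiv 𝓘(ℝ, E) 𝓘(ℝ, E) e.symm y)
  ContinuousLinearMap.comp (M₂ := E)
    (fderiv ℝ η' (e x) (V' (e x)) + (η' (e x)).comp (fderiv ℝ V' (e x)))
    (mfderiv 𝓘(ℝ, E) 𝓘(ℝ, E) e x)

/-- The differential of a function, as a one-form. -/
def dFun (f : M → ℝ) (x : M) : TangentSpace 𝓘(ℝ, E) x →L[ℝ] ℝ :=
  mfderiv 𝓘(ℝ, E) 𝓘(ℝ, ℝ) f x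

namespace GenField

/-- The Courant bracket `[X + ξ, Y + η] = [X, Y] + L_X η - L_Y ξ - 1/2 d (i_X η - i_Y ξ)`. -/
def courant (A B : GenField E M) : GenField E M where
  vec := VectorField.mlieBracket 𝓘(ℝ, E) A.vec B.vec
  form x := lieDerivForm A.vec B.form x - lieDerivForm B.vec A.form x -
    (1 / 2 : ℝ) • dFun (fun y => B.form y (A.vec y) - A.form y (B.vec y)) x

/-- The inner product `⟨X + ξ, Y + η⟩ = 1/2 (ξ(Y) + η(X))`. -/
def pair (A B : GenField E M) (x : M) : ℝ :=
  (1 / 2 : ℝ) * (A.form x (B.vec x) + B.form x (A.vec x))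

/-- The Nijenhuis operator
`Nij(A, B, C) = 1/3 (⟨[A, B], C⟩ + ⟨[B, C], A⟩ + ⟨[C, A], B⟩)`. -/
def nij (A B C : GenField E M) (x : M) : ℝ :=
  (1 / 3 : ℝ) * (pair (courant A B) C x + pair (courant B C) A x + pair (courant C A) B x)

/-- Smoothness of the vector field and of the one-form on a set. -/
def SmoothOn [IsManifold 𝓘(ℝ, E) ∞ M] (A : GenField E M) (s : Set M) : Prop :=
  ContMDiffOn 𝓘(ℝ, E) (𝓘(ℝ, E).prod 𝓘(ℝ, E)) ∞
    (fun x => (⟨x, A.vec x⟩ : TangentBundle 𝓘(ℝ, E) M)) s ∧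
  ContMDiffOn 𝓘(ℝ, E) (𝓘(ℝ, E).prod 𝓘(ℝ, E →L[ℝ] ℝ)) ∞
    (fun x => (⟨x, A.form x⟩ : Bundle.TotalSpace (E →L[ℝ] ℝ)
      (fun x : M => TangentSpace 𝓘(ℝ, E) x →L[ℝ] Bundle.Trivial M ℝ x))) s

end GenField

end Courant

section Flag

open LieAlgebra LieAlgebra.IsKilling Module

variable {g : Type*} [LieRing g] [LieAlgebra ℝ g] [FiniteDimensional ℝ g] [LieAlgebra.IsKilling ℝ g]
  {H : LieSubalgebra ℝ g} [H.IsCartanSubalgebra] [LieModule.IsTriangularizable ℝ H g]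
  (B : (rootSystem H).Base) (Θ : Set B.support)

/-- `α` is an integral combination of the simple roots in `Θ`. -/
def GeneratedBy (α : H.root) : Prop :=
  (rootSystem H).root α ∈ AddSubgroup.closure ((fun i : B.support => (rootSystem H).root i) '' Θ)

/-- The parabolic subalgebra `p_Θ`: the Cartan subalgebra, the positive root spaces and the root
spaces of the (negative) roots generated by `Θ`. -/
def pTheta : Submodule ℝ g :=
  H.toSubmodule ⊔ ⨆ α : H.root, ⨆ _ : B.IsPos α ∨ GeneratedBy B Θ α,
    (rootSpace H (α : LieModule.Weight ℝ H g)).toSubmodule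

/-- `n_Θ⁻`: the sum of the root spaces of the negative roots not generated by `Θ`. -/
def nMinus : Submodule ℝ g :=
  ⨆ α : H.root, ⨆ _ : ¬ B.IsPos α ∧ ¬ GeneratedBy B Θ α,
    (rootSpace H (α : LieModule.Weight ℝ H g)).toSubmodule

/-- `n_Θ⁺`: the sum of the root spaces of the positive roots not generated by `Θ`. -/
def nPlus : Submodule ℝ g :=
  ⨆ α : H.root, ⨆ _ : B.IsPos α ∧ ¬ GeneratedBy B Θ α,
    (rootSpace H (α : LieModule.Weight ℝ H g)).toSubmodule

lemma exists_gradingElement : ∃ D : H, ∀ i : B.support,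
    ((rootSystem H).root i D = 0 ∨ (rootSystem H).root i D = 1) ∧
    ((rootSystem H).root i D = 0 ↔ i ∈ Θ) := by
  classical
  let f : Dual ℝ H →ₗ[ℝ] ℝ := B.toWeightBasis.constr ℝ (fun i => if i ∈ Θ then (0 : ℝ) else 1)
  refine ⟨(Module.evalEquiv ℝ H).symm f, fun i => ?_⟩
  have h1 : (rootSystem H).root i ((Module.evalEquiv ℝ H).symm f) = if i ∈ Θ then (0 : ℝ) else 1 := by
    rw [Module.apply_evalEquiv_symm_apply]
    have := B.toWeightBasis.constr_basis ℝ (fun i => if i ∈ Θ then (0 : ℝ) else 1) i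
    rwa [B.toWeightBasis_apply] at this
  rw [h1]
  by_cases hi : i ∈ Θ <;> simp [hi]

/-- An element of the Cartan subalgebra on which the simple roots in `Θ` vanish and the other simple
roots take the value `1`. -/
def gradingElement : H := (exists_gradingElement B Θ).choose

lemma generatedBy_apply {α : H.root} (hα : GeneratedBy B Θ α) :
    (rootSystem H).root α (gradingElement B Θ) = 0 := by
  unfold GeneratedBy at hα
  generalize (rootSystem H).root α = x at hα
  induction hα using AddSubgroup.closure_induction with
  | mem x hx =>
    obtain ⟨i, hi, rfl⟩ := hx
    exact ((exists_gradingElement B Θ).choose_spec i).2.2 hi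
  | zero => rfl
  | add x y _ _ hx hy => rw [LinearMap.add_apply, hx, hy, add_zero]
  | neg x _ hx => rw [LinearMap.neg_apply, hx, neg_zero]

lemma closure_apply {x : Dual ℝ H}
    (hx : x ∈ AddSubmonoid.closure ((rootSystem H).root '' B.support)) :
    ∃ k : ℕ, x (gradingElement B Θ) = k ∧ (k = 0 → x ∈ AddSubgroup.closure
      ((fun i : B.support => (rootSystem H).root i) '' Θ)) := by
  induction hx using AddSubmonoid.closure_induction with
  | mem x hx =>
    obtain ⟨i, hi, rfl⟩ := hx
    obtain ⟨h1, h2⟩ := (exists_gradingElement B Θ).choose_spec ⟨i, hi⟩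
    rcases h1 with h1 | h1
    · exact ⟨0, h1.trans Nat.cast_zero.symm, fun _ => AddSubgroup.subset_closure ⟨⟨i, hi⟩, h2.1 h1, rfl⟩⟩
    · exact ⟨1, h1.trans Nat.cast_one.symm, fun h => absurd h one_ne_zero⟩
  | zero => exact ⟨0, by simp, fun _ => zero_mem _⟩
  | add x y _ _ hx hy =>
    obtain ⟨k, hk, hk'⟩ := hx
    obtain ⟨l, hl, hl'⟩ := hy
    refine ⟨k + l, by rw [LinearMap.add_apply, hk, hl]; push_cast; rfl, fun h => ?_⟩
    exact add_mem (hk' (by omega)) (hl' (by omega))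

lemma root_mem_closure {α : H.root} (hα : B.IsPos α) :
    (rootSystem H).root α ∈ AddSubmonoid.closure ((rootSystem H).root '' B.support) := by
  obtain ⟨f, hf, h | h⟩ := B.exists_root_eq_sum_nat_or_neg α
  · rw [h]
    exact sum_mem fun j hj => nsmul_mem (AddSubmonoid.subset_closure (Set.mem_image_of_mem _ hj)) _
  · exfalso
    have h1 : (rootSystem H).root α = ∑ j ∈ B.support, (-(f j : ℤ)) • (rootSystem H).root j := by
      rw [h]; simp
    have h2 := B.height_eq_sum h1
    have h3 : (0 : ℤ) < B.height α := hα
    rw [h2, Finset.sum_neg_distrib] at h3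
    have : (0 : ℤ) ≤ ∑ j ∈ B.support, (f j : ℤ) := Finset.sum_nonneg fun j _ => by positivity
    omega

lemma neg_root_mem_closure {α : H.root} (hα : ¬ B.IsPos α) :
    -(rootSystem H).root α ∈ AddSubmonoid.closure ((rootSystem H).root '' B.support) := by
  obtain ⟨f, hf, h | h⟩ := B.exists_root_eq_sum_nat_or_neg α
  · exfalso
    apply hα
    have h1 : (rootSystem H).root α = ∑ j ∈ B.support, ((f j : ℤ)) • (rootSystem H).root j := by
      rw [h]; simp
    have h2 := B.height_eq_sum h1
    rw [RootPairing.Base.isPos_iff', h2]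
    exact Finset.sum_nonneg fun j _ => by positivity
  · rw [h, neg_neg]
    exact sum_mem fun j hj => nsmul_mem (AddSubmonoid.subset_closure (Set.mem_image_of_mem _ hj)) _

lemma rootSpace_le_eig {α : H.root} {c : ℝ} (hc : (rootSystem H).root α (gradingElement B Θ) = c) :
    (rootSpace H (α : LieModule.Weight ℝ H g)).toSubmodule ≤ eig (gradingElement B Θ : g) c := by
  intro x hx
  rw [mem_eig, ← hc]
  exact lie_eq_smul_of_mem_rootSpace hx (gradingElement B Θ)

lemma isGrading : IsGrading (gradingElement B Θ : g) (pTheta B Θ) (nMinus B Θ) where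
  p_le := by
    refine sup_le ?_ (iSup₂_le fun α hα => ?_)
    · refine le_trans ?_ (le_iSup (fun k : ℕ => eig (gradingElement B Θ : g) (k : ℝ)) 0)
      intro x hx
      rw [mem_eig]
      have : ⁅gradingElement B Θ, (⟨x, hx⟩ : H)⁆ = 0 := trivial_lie_zero _ _ _ _
      simpa using congrArg Subtype.val this
    · have : ∃ k : ℕ, (rootSystem H).root α (gradingElement B Θ) = k := by
        rcases hα with hα | hα
        · obtain ⟨k, hk, -⟩ := closure_apply B Θ (root_mem_closure B hα)
          exact ⟨k, hk⟩
        · exact ⟨0, by simpa using generatedBy_apply B Θ hα⟩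
      obtain ⟨k, hk⟩ := this
      exact (rootSpace_le_eig B Θ hk).trans
        (le_iSup (fun k : ℕ => eig (gradingElement B Θ : g) (k : ℝ)) k)
  n_le := by
    refine iSup₂_le fun α hα => ?_
    obtain ⟨k, hk, hk'⟩ := closure_apply B Θ (neg_root_mem_closure B hα.1)
    have hk0 : k ≠ 0 := fun h => hα.2 (by
      have := neg_mem (hk' h)
      rwa [neg_neg] at this)
    obtain ⟨l, rfl⟩ := Nat.exists_eq_succ_of_ne_zero hk0
    rw [LinearMap.neg_apply] at hk
    have hl : (rootSystem H).root α (gradingElement B Θ) = -((l : ℝ) + 1) := by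
      rw [← neg_eq_iff_eq_neg, hk]; push_cast; rfl
    exact (rootSpace_le_eig B Θ hl).trans
      (le_iSup (fun k : ℕ => eig (gradingElement B Θ : g) (-((k : ℝ) + 1))) l)
  top := by
    have h1 : (⨆ χ : LieModule.Weight ℝ H g, (rootSpace H χ).toSubmodule) = ⊤ := by
      rw [← LieSubmodule.iSup_toSubmodule, LieModule.iSup_genWeightSpace_eq_top' ℝ H g]
      rfl
    rw [eq_top_iff, ← h1]
    refine iSup_le fun χ => ?_
    by_cases hχ : χ.IsZero
    · refine le_sup_of_le_left (le_sup_of_le_left ?_)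
      have : (χ : H → ℝ) = 0 := hχ
      rw [this]
      intro x hx
      rwa [LieSubmodule.mem_toSubmodule, ← LieSubmodule.mem_toSubmodule,
        LieAlgebra.rootSpace_zero_eq ℝ g H] at hx
    · have hr : χ ∈ H.root := by simpa using hχ
      by_cases hp : B.IsPos ⟨χ, hr⟩ ∨ GeneratedBy B Θ ⟨χ, hr⟩
      · exact le_sup_of_le_left (le_sup_of_le_right
          (le_iSup₂_of_le (⟨χ, hr⟩ : H.root) hp le_rfl))
      · exact le_sup_of_le_right (le_iSup₂_of_le (⟨χ, hr⟩ : H.root) (not_or.1 hp) le_rfl)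

/-- The flag manifold `F_Θ = G / P_Θ`, where `G` is the group of inner automorphisms of `g` and
`P_Θ` is the normalizer of `p_Θ` in `G`. -/
def FlagManifold : Type _ := Homog (pTheta B Θ)

namespace FlagManifold

instance : MulAction (Inn g) (FlagManifold B Θ) :=
  inferInstanceAs (MulAction (Inn g) (Homog (pTheta B Θ)))

instance : TopologicalSpace (FlagManifold B Θ) := (Homog.core (isGrading B Θ)).toTopologicalSpace

/-- The charts of the flag manifold are the translates by `G` of the chart on the open cell of
conjugates of `p_Θ` complementary to `n_Θ⁻`. -/
instance : ChartedSpace (nMinus B Θ) (FlagManifold B Θ) :=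
  (Homog.core (isGrading B Θ)).toChartedSpace

instance : IsManifold 𝓘(ℝ, nMinus B Θ) ∞ (FlagManifold B Θ) :=
  Homog.isManifold_core (isGrading B Θ)

/-- The origin `b_Θ` of the flag manifold. -/
def origin : FlagManifold B Θ := Homog.mk (pTheta B Θ) 1

/-- `n_Θ⁻` is closed under the bracket. -/
lemma lie_mem_nMinus {X Y : g} (hX : X ∈ nMinus B Θ) (hY : Y ∈ nMinus B Θ) : ⁅X, Y⁆ ∈ nMinus B Θ :=
  Homog.lie_mem_n (isGrading B Θ) hX hY

/-- The Lie bracket of two elements of `n_Θ⁻`. -/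
def bracketMinus (X Y : nMinus B Θ) : nMinus B Θ := ⟨⁅(X : g), (Y : g)⁆, lie_mem_nMinus B Θ X.2 Y.2⟩

/-- The identification of `n_Θ⁻` with the tangent space at the origin: `X` corresponds to the
velocity at `t = 0` of the curve `e ^ (t ad X) b_Θ`. -/
def tangentId : nMinus B Θ →L[ℝ] TangentSpace 𝓘(ℝ, nMinus B Θ) (origin B Θ) :=
  mfderiv 𝓘(ℝ, nMinus B Θ) 𝓘(ℝ, nMinus B Θ)
    (fun X : nMinus B Θ => expAd (X : g) • origin B Θ) 0

/-- The covector at the origin defined by a linear form on `g`, restricted to `n_Θ⁻`. -/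
def cotangentId (φ : Module.Dual ℝ g) :
    TangentSpace 𝓘(ℝ, nMinus B Θ) (origin B Θ) →L[ℝ] ℝ :=
  (LinearMap.toContinuousLinearMap (φ ∘ₗ (nMinus B Θ).subtype)).comp (tangentId B Θ).inverse

/-- The connected subgroup `N_Θ⁻` of `G` with Lie algebra `n_Θ⁻`. -/
def NMinus : Subgroup (Inn g) := Subgroup.closure (expAd '' (nMinus B Θ : Set g))

/-- The open cell `N_Θ⁻ b_Θ`. -/
def openCell : Set (FlagManifold B Θ) := {q | ∃ u ∈ NMinus B Θ, u • origin B Θ = q}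

/-- The translation of the flag manifold by `u ∈ G`. -/
def translate (u : Inn g) (q : FlagManifold B Θ) : FlagManifold B Θ := u • q

open Classical in
/-- The `N_Θ⁻`-invariant generalized vector field on the open cell with value `v + ξ` at the origin
(and zero outside of the open cell). The element of `N_Θ⁻` taking the origin to `q` is unique. -/
def invariantExt (v : TangentSpace 𝓘(ℝ, nMinus B Θ) (origin B Θ))
    (ξ : TangentSpace 𝓘(ℝ, nMinus B Θ) (origin B Θ) →L[ℝ] ℝ) :
    GenField (nMinus B Θ) (FlagManifold B Θ) where
  vec q := if hq : q ∈ openCell B Θ then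
      (mfderiv 𝓘(ℝ, nMinus B Θ) 𝓘(ℝ, nMinus B Θ) (translate B Θ hq.choose) (origin B Θ) v :
        nMinus B Θ)
    else 0
  form q := if hq : q ∈ openCell B Θ then
      ContinuousLinearMap.comp (M₂ := nMinus B Θ) ξ
        (mfderiv 𝓘(ℝ, nMinus B Θ) 𝓘(ℝ, nMinus B Θ) (translate B Θ hq.choose⁻¹) q)
    else 0

/-- The generalized vector field `X + Z*` for `X ∈ n_Θ⁻` and `Z* = ⟨Z, ·⟩` with `Z ∈ n_Θ⁺`, where
`⟨·, ·⟩` is the Killing form. -/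
def invariantField (X : nMinus B Θ) (Z : nPlus B Θ) :
    GenField (nMinus B Θ) (FlagManifold B Θ) :=
  invariantExt B Θ (tangentId B Θ X) (cotangentId B Θ (killingForm ℝ g (Z : g)))

end FlagManifold

end Flag

end

end RealFlag

open RealFlag RealFlag.FlagManifold

/-! Let `D` be the grading element: the simple roots in `Θ` vanish on it and the others equal 1.
Then `pTheta` is the sum of the eigenspaces of `ad D` of degree at least 0, and `nMinus` that of
degree at most -1. A conjugate of `pTheta` transversal to `nMinus` contains exactly one element `D +
Z` with `Z` in `nMinus`; this `Z` is its coordinate. The group `NMinus` preserves `D + nMinus`, so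
in this chart it acts by affine maps (`Homog.smul_chart_symm`). Its elements are unipotent for the
grading, so one that fixes `D` is the identity (`eq_one_of_act_grading`), and the action on the
orbit of 0 is free. The orbit map `X ↦ e^(ad X) D - D` has derivative `X ↦ [X, D]` at 0, an
automorphism of `nMinus`; by the inverse function theorem the orbit is open and the invariant
sections are smooth.

At the point `e^(ad U) D - D` the invariant field of `X` has the value `e^(ad U) [X, D]`. The
bracket of two such fields at 0 is therefore `[X, [Y, D]] - [Y, [X, D]] = [[X, Y], D]`, the value of
the field of `[X, Y]` (`lieBracket_coordField`). An invariant form pairs with an invariant field to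
a constant (`invariantField_form_vec`). Hence the exact term of the Courant bracket vanishes, and
Cartan's formula reduces `(L_V η)(W)` to `-η([V, W])` (`lieDerivForm_apply_of_const`), which is the
coadjoint action. Pairing the result with a third section gives a cyclically symmetric expression,
so the three terms of the Nijenhuis operator agree and the factor 1/3 cancels.

The dual of `nMinus` is `nPlus` because the Killing form is nondegenerate and pairs degrees `a` and
`b` to zero unless `a + b = 0` (`cotangentId_bijective`). -/

namespace RealFlag

noncomputable section

/-! ### Unipotent action of the group generated by `e^(ad n)`, and its affine action on `n`. -/

section Lowering

variable {g : Type*} [LieRing g] [LieAlgebra ℝ g] [FiniteDimensional ℝ g]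
  {D : g} {p n : Submodule ℝ g}

/-- The sum of the eigenspaces of `ad D` for the eigenvalues `c, c - 1, c - 2, …`. -/
def lowerFil (D : g) (c : ℝ) : Submodule ℝ g := ⨆ j : ℕ, eig D (c - j)

lemma eig_le_lowerFil (D : g) (c : ℝ) : eig D c ≤ lowerFil D c := by
  refine le_trans (le_of_eq ?_) (le_iSup (fun j : ℕ => eig D (c - j)) 0)
  simp

lemma lowerFil_sub_one_le (D : g) (c : ℝ) : lowerFil D (c - 1) ≤ lowerFil D c := by
  refine iSup_le fun j => le_trans (le_of_eq ?_) (le_iSup (fun j : ℕ => eig D (c - j)) (j + 1))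
  push_cast; congr 1; ring

lemma IsGrading.lowerFil_neg_one (h : IsGrading D p n) : lowerFil D (-1) = n := by
  rw [h.n_eq]; unfold lowerFil
  congr 1; ext1 k; congr 1; ring

/-- Degrees add under the bracket, and those of `n` are at most -1. -/
lemma lie_mem_lowerFil (h : IsGrading D p n) {X x : g} {c : ℝ} (hX : X ∈ n)
    (hx : x ∈ lowerFil D c) : ⁅X, x⁆ ∈ lowerFil D (c - 1) := by
  rw [h.n_eq] at hX
  induction hX using Submodule.iSup_induction' with
  | zero => simp
  | add a b _ _ ha hb => rw [add_lie]; exact add_mem ha hb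
  | mem i X hX =>
    unfold lowerFil at hx
    induction hx using Submodule.iSup_induction' with
    | zero => simp
    | add a b _ _ ha hb => rw [lie_add]; exact add_mem ha hb
    | mem j y hy =>
      have h1 := IsGrading.lie_mem_eig hX hy
      refine le_iSup (fun j : ℕ => eig D (c - 1 - j)) (i + j) ?_
      push_cast
      convert h1 using 2
      ring

lemma exp_adL_sub_mem_lowerFil (h : IsGrading D p n) {X x : g} {c : ℝ} (hX : X ∈ n)
    (hx : x ∈ lowerFil D c) : act (expAd X) x - x ∈ lowerFil D (c - 1) := by
  have h1 := lie_mem_lowerFil h hX hx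
  have h2 := IsGrading.exp_sub_mem (T := adL X) (V := lowerFil D (c - 1)) (x := x)
    (fun y hy => lowerFil_sub_one_le D _ (lie_mem_lowerFil h hX hy))
    (lowerFil_sub_one_le D _ (lie_mem_lowerFil h hX h1))
  have h3 := add_mem h2 h1
  rw [act_expAd]
  rwa [adL_apply, sub_add_cancel] at h3

lemma inv_expAd (X : g) : (expAd X)⁻¹ = expAd (-X) := by
  apply Subtype.ext
  apply Units.ext
  change NormedSpace.exp (-adL X) = NormedSpace.exp (adL (-X))
  congr 1
  ext; simp

/-- The subgroup of inner automorphisms generated by `e ^ (ad X)` for `X ∈ n`. -/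
def expGroup (n : Submodule ℝ g) : Subgroup (Inn g) := Subgroup.closure (expAd '' (n : Set g))

lemma expAd_mem_expGroup {X : g} (hX : X ∈ n) : expAd X ∈ expGroup n :=
  Subgroup.subset_closure ⟨X, hX, rfl⟩

/-- Unipotency: each generator is the identity plus terms that lower the degree, and this persists
under products and inverses. -/
lemma act_sub_mem_lowerFil (h : IsGrading D p n) {u : Inn g} (hu : u ∈ expGroup n) {x : g} {c : ℝ}
    (hx : x ∈ lowerFil D c) : act u x - x ∈ lowerFil D (c - 1) := by
  -- The claim for `u⁻¹` is carried along so that the inverse case of the closure induction is a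
  -- swap; the product case needs all `x`, since it is applied to `act v x`.
  suffices H : ∀ (c : ℝ) (x : g), x ∈ lowerFil D c → act u x - x ∈ lowerFil D (c - 1) ∧
      act u⁻¹ x - x ∈ lowerFil D (c - 1) from (H c x hx).1
  clear hx x c
  have hmul : ∀ u v : Inn g, (∀ (c : ℝ) (x : g), x ∈ lowerFil D c →
      act u x - x ∈ lowerFil D (c - 1)) → (∀ (c : ℝ) (x : g), x ∈ lowerFil D c →
      act v x - x ∈ lowerFil D (c - 1)) → ∀ (c : ℝ) (x : g), x ∈ lowerFil D c →
      act (u * v) x - x ∈ lowerFil D (c - 1) := fun u v hu hv c x hx => by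
    have h1 := hv c x hx
    have h2 : act v x ∈ lowerFil D c := by
      have := add_mem (lowerFil_sub_one_le D c h1) hx
      rwa [sub_add_cancel] at this
    have := add_mem (hu c _ h2) h1
    rwa [sub_add_sub_cancel, ← act_mul] at this
  unfold expGroup at hu
  induction hu using Subgroup.closure_induction with
  | mem u hu =>
    obtain ⟨X, hX, rfl⟩ := hu
    exact fun c x hx => ⟨exp_adL_sub_mem_lowerFil h hX hx,
      by rw [inv_expAd]; exact exp_adL_sub_mem_lowerFil h (neg_mem hX) hx⟩
  | one => intro c x _; simp [act_one]
  | mul u v _ _ hu hv =>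
    intro c x hx
    refine ⟨hmul u v (fun c x hx => (hu c x hx).1) (fun c x hx => (hv c x hx).1) c x hx, ?_⟩
    rw [mul_inv_rev]
    exact hmul _ _ (fun c x hx => (hv c x hx).2) (fun c x hx => (hu c x hx).2) c x hx
  | inv u _ hu => intro c x hx; rw [inv_inv]; exact (hu c x hx).symm

lemma act_mem_of_mem_expGroup (h : IsGrading D p n) {u : Inn g} (hu : u ∈ expGroup n) {x : g}
    (hx : x ∈ n) : act u x ∈ n := by
  rw [← h.lowerFil_neg_one] at hx ⊢
  have := add_mem (lowerFil_sub_one_le D _ (act_sub_mem_lowerFil h hu hx)) hx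
  rwa [sub_add_cancel] at this

lemma act_grading_sub_mem (h : IsGrading D p n) {u : Inn g} (hu : u ∈ expGroup n) :
    act u D - D ∈ n := by
  rw [← h.lowerFil_neg_one]
  have := act_sub_mem_lowerFil h hu (x := D) (c := 0)
    (eig_le_lowerFil D 0 (mem_eig.2 (by simp)))
  rwa [zero_sub] at this

/-- An element of the group generated by `e ^ (ad n)` that fixes `D` is the identity. -/
lemma eq_one_of_act_grading (h : IsGrading D p n) {u : Inn g} (hu : u ∈ expGroup n)
    (hD : act u D = D) : u = 1 := by
  have key : ∀ (c : ℝ) (x : g), x ∈ eig D c → act u x = x := fun c x hx => by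
    -- Being a Lie algebra automorphism that fixes `D`, `u` commutes with `ad D`.
    have h1 : act u x ∈ eig D c := by
      rw [mem_eig]
      conv_lhs => rw [← hD]
      rw [← act_lie, mem_eig.1 hx, map_smul]
    have h2 := act_sub_mem_lowerFil h hu (eig_le_lowerFil D c hx)
    have h3 := (Module.End.eigenspaces_iSupIndep (LieAlgebra.ad ℝ g D)) c
    -- The difference has degree `c` and also degrees at most `c - 1`; independence of the
    -- eigenspaces makes it zero.
    have h4 : lowerFil D (c - 1) ≤ ⨆ d, ⨆ (_ : d ≠ c), eig D d := by
      refine iSup_le fun j => le_iSup₂_of_le (c - 1 - j) ?_ le_rfl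
      have : (0 : ℝ) ≤ j := j.cast_nonneg
      intro e; linarith
    have h5 : act u x - x ∈ eig D c ⊓ ⨆ d, ⨆ (_ : d ≠ c), eig D d := ⟨sub_mem h1 hx, h4 h2⟩
    rw [disjoint_iff.1 h3, Submodule.mem_bot, sub_eq_zero] at h5
    exact h5
  have hall : ∀ x : g, act u x = x := fun x => by
    have hx : x ∈ ⨆ c : ℝ, eig D c := by rw [h.iSup_eig]; trivial
    induction hx using Submodule.iSup_induction' with
    | zero => simp
    | add a b _ _ ha hb => rw [map_add, ha, hb]
    | mem c x hx => exact key c x hx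
  apply Subtype.ext
  apply Units.ext
  ext x
  exact hall x

/-- The action of an element of `expGroup n` on `n`. -/
def actN (n : Submodule ℝ g) (h : IsGrading D p n) (u : expGroup n) : n →L[ℝ] n :=
  ((act (u : Inn g)).comp n.subtypeL).codRestrict n fun x => act_mem_of_mem_expGroup h u.2 x.2

@[simp] lemma coe_actN (h : IsGrading D p n) (u : expGroup n) (x : n) :
    (actN n h u x : g) = act (u : Inn g) x := rfl

lemma actN_mul (h : IsGrading D p n) (u v : expGroup n) (x : n) :
    actN n h (u * v) x = actN n h u (actN n h v x) := rfl

lemma actN_one (h : IsGrading D p n) (x : n) : actN n h 1 x = x := rfl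

/-- The affine action of `expGroup n` on `n` obtained by translating `D + n` to `n`. -/
def aff (h : IsGrading D p n) (u : expGroup n) (Z : n) : n :=
  actN n h u Z + ⟨act (u : Inn g) D - D, act_grading_sub_mem h u.2⟩

/-- This equation characterizes `aff`; identities for the affine action are read off from the linear
action on `D + n` by cancelling `D`. -/
lemma add_aff (h : IsGrading D p n) (u : expGroup n) (Z : n) :
    D + (aff h u Z : g) = act (u : Inn g) (D + Z) := by
  rw [aff, Submodule.coe_add, coe_actN, map_add, add_left_comm, add_sub_cancel, add_comm]

lemma aff_mul (h : IsGrading D p n) (u v : expGroup n) (Z : n) :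
    aff h (u * v) Z = aff h u (aff h v Z) := by
  apply Subtype.ext
  apply add_left_cancel (a := D)
  rw [add_aff, add_aff, add_aff]; rfl

lemma aff_one (h : IsGrading D p n) (Z : n) : aff h 1 Z = Z := by
  apply Subtype.ext
  apply add_left_cancel (a := D)
  rw [add_aff]; rfl

lemma hasFDerivAt_aff (h : IsGrading D p n) (u : expGroup n) (Z : n) :
    HasFDerivAt (aff h u) (actN n h u) Z :=
  (actN n h u).hasFDerivAt.add_const _

lemma contDiff_aff (h : IsGrading D p n) (u : expGroup n) : ContDiff ℝ ∞ (aff h u) :=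
  (actN n h u).contDiff.add contDiff_const

/-- The affine action of `expGroup n` on `n` is free. -/
lemma aff_zero_injective (h : IsGrading D p n) : Function.Injective fun u => aff h u 0 := by
  intro u v huv
  have h1 : aff h (v⁻¹ * u) 0 = 0 := by
    simp only at huv
    rw [aff_mul, huv, ← aff_mul, inv_mul_cancel, aff_one]
  have h2 := add_aff h (v⁻¹ * u) 0
  rw [h1, Submodule.coe_zero, add_zero] at h2
  have h3 : v⁻¹ * u = 1 := Subtype.ext (eq_one_of_act_grading h (v⁻¹ * u).2 h2.symm)
  exact (inv_mul_eq_one.1 h3).symm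

/-- The linear map `X ↦ [X, D]` on `n`. -/
def lieD (h : IsGrading D p n) : n →ₗ[ℝ] n where
  toFun X := ⟨⁅(X : g), D⁆, by
    have h1 := lie_mem_lowerFil h X.2 (eig_le_lowerFil D 0 (mem_eig.2 (by simp)) : D ∈ _)
    rwa [zero_sub, h.lowerFil_neg_one] at h1⟩
  map_add' X Y := Subtype.ext (by simp)
  map_smul' c X := Subtype.ext (by simp)

/-- An element of `n` that commutes with `D` has degree 0, hence lies in `p`, which meets `n`
trivially. -/
lemma lieD_injective (h : IsGrading D p n) : Function.Injective (lieD h) := by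
  rw [← LinearMap.ker_eq_bot, LinearMap.ker_eq_bot']
  intro X hX
  have h1 : ⁅(X : g), D⁆ = 0 := congrArg Subtype.val hX
  have h2 : (X : g) ∈ p := by
    apply h.eig_le_p 0
    rw [mem_eig, ← lie_skew, h1]; simp
  have h3 : (X : g) ∈ p ⊓ n := ⟨h2, X.2⟩
  rw [h.isCompl.inf_eq_bot, Submodule.mem_bot] at h3
  exact Subtype.ext h3

/-- `X ↦ [X, D]` as an automorphism of the vector space `n`. -/
def lieDEquiv (h : IsGrading D p n) : n ≃L[ℝ] n :=
  (LinearEquiv.ofInjectiveEndo (lieD h) (lieD_injective h)).toContinuousLinearEquiv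

@[simp] lemma coe_lieDEquiv (h : IsGrading D p n) (X : n) : (lieDEquiv h X : g) = ⁅(X : g), D⁆ := rfl

end Lowering

/-! ### The orbit of 0, its smooth local sections, and the invariant vector fields in coordinates.
-/

section LocalSection

variable {g : Type*} [LieRing g] [LieAlgebra ℝ g] [FiniteDimensional ℝ g]
  {D : g} {p n : Submodule ℝ g}

/-- `e ^ (ad X)` for `X ∈ n`, as an element of `expGroup n`. -/
def expN (X : n) : expGroup n := ⟨expAd X, expAd_mem_expGroup X.2⟩

/-- `adL` as a continuous linear map on `n`. -/
def adN (n : Submodule ℝ g) : n →L[ℝ] (g →L[ℝ] g) := LinearMap.toContinuousLinearMap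
  { toFun := fun Z : n => adL (Z : g)
    map_add' := fun a b => by ext; simp
    map_smul' := fun c a => by ext; simp }

@[simp] lemma adN_apply (X : n) : adN n X = adL (X : g) := rfl

lemma contDiff_expAd (n : Submodule ℝ g) : ContDiff ℝ ∞ fun X : n => NormedSpace.exp (adL (X : g)) := by
  have h1 : ContDiff ℝ ∞ (NormedSpace.exp : (g →L[ℝ] g) → (g →L[ℝ] g)) :=
    contDiff_iff_contDiffAt.2 fun x => (NormedSpace.exp_analytic (𝕂 := ℝ) x).contDiffAt
  exact h1.comp (adN n).contDiff

lemma hasStrictFDerivAt_expAd (n : Submodule ℝ g) :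
    HasStrictFDerivAt (fun X : n => NormedSpace.exp (adL (X : g))) (adN n) 0 := by
  have h1 : HasStrictFDerivAt (NormedSpace.exp : (g →L[ℝ] g) → (g →L[ℝ] g))
      (1 : (g →L[ℝ] g) →L[ℝ] (g →L[ℝ] g)) (adN n 0) := by
    rw [map_zero]; exact hasStrictFDerivAt_exp_zero
  exact h1.comp 0 (adN n).hasStrictFDerivAt

/-- The orbit map `X ↦ e ^ (ad X) D - D` in coordinates. -/
def orbitMap (h : IsGrading D p n) (X : n) : n := aff h (expN X) 0

/-- The difference already lies in `n`, so projecting changes nothing; this form is a composite of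
smooth maps to which calculus applies. -/
lemma orbitMap_eq (h : IsGrading D p n) (X : n) :
    orbitMap h X = (LinearMap.toContinuousLinearMap (n.projectionOnto p h.isCompl.symm))
      (NormedSpace.exp (adL (X : g)) D - D) := by
  have h1 : NormedSpace.exp (adL (X : g)) D - D = (orbitMap h X : g) := by
    rw [sub_eq_iff_eq_add', orbitMap, add_aff, Submodule.coe_zero, add_zero]
    rfl
  rw [h1]
  exact (Submodule.projectionOnto_apply_left h.isCompl.symm _).symm

lemma contDiff_orbitMap (h : IsGrading D p n) : ContDiff ℝ ∞ (orbitMap h) := by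
  have : orbitMap h = _ := funext (orbitMap_eq h)
  rw [this]
  exact (ContinuousLinearMap.contDiff _).comp
    (((contDiff_expAd n).clm_apply contDiff_const).sub contDiff_const)

lemma orbitMap_zero (h : IsGrading D p n) : orbitMap h 0 = 0 := by
  rw [orbitMap_eq]
  have : adL ((0 : n) : g) = 0 := by ext; simp
  rw [this, NormedSpace.exp_zero]; simp

/-- The first-order term of `e^(ad X) D` is `[X, D]`. Invertibility of this derivative feeds the
inverse function theorem. -/
lemma hasStrictFDerivAt_orbitMap (h : IsGrading D p n) :
    HasStrictFDerivAt (orbitMap h) (lieDEquiv h : n →L[ℝ] n) 0 := by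
  have : orbitMap h = _ := funext (orbitMap_eq h)
  rw [this]
  have h1 := ((LinearMap.toContinuousLinearMap
    (n.projectionOnto p h.isCompl.symm)).hasStrictFDerivAt).comp (0 : n)
    (((hasStrictFDerivAt_expAd n).clm_apply (hasStrictFDerivAt_const D (0 : n))).sub_const D)
  refine h1.congr_fderiv (ContinuousLinearMap.ext fun X => ?_)
  have h2 : ⁅(X : g), D⁆ = (lieDEquiv h X : g) := rfl
  simp [h2, -coe_lieDEquiv]

/-- The orbit of `0` under the affine action. -/
def affOrbit (h : IsGrading D p n) : Set n := Set.range fun u => aff h u 0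

open Classical in
/-- The element of `expGroup n` that takes `0` to `Z` in the affine action. -/
def orbitSection (h : IsGrading D p n) (Z : n) : expGroup n :=
  if hZ : Z ∈ affOrbit h then hZ.choose else 1

/-- Freeness of the action leaves no ambiguity in the choice. -/
lemma orbitSection_aff (h : IsGrading D p n) (u : expGroup n) : orbitSection h (aff h u 0) = u := by
  have hZ : aff h u 0 ∈ affOrbit h := ⟨u, rfl⟩
  rw [orbitSection, dif_pos hZ]
  exact aff_zero_injective h hZ.choose_spec

/-- The section is the local inverse of the orbit map given by the inverse function theorem. -/
lemma exists_local_section (h : IsGrading D p n) : ∃ s : n → n, ContDiffAt ℝ ∞ s 0 ∧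
    ∀ᶠ Z in 𝓝 (0 : n), orbitMap h (s Z) = Z := by
  have h1 := (hasStrictFDerivAt_orbitMap h)
  have hc : ContDiffAt ℝ ∞ (orbitMap h) 0 := (contDiff_orbitMap h).contDiffAt
  refine ⟨hc.localInverse h1.hasFDerivAt (by simp), ?_, ?_⟩
  · have := hc.to_localInverse h1.hasFDerivAt (by simp)
    rwa [orbitMap_zero] at this
  · have := (hc.hasStrictFDerivAt' h1.hasFDerivAt (by simp)).eventually_right_inverse
    rw [orbitMap_zero] at this
    exact this

/-- By homogeneity, the section at 0 is transported to any point of the orbit with `aff h u⁻¹`. -/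
lemma exists_local_section_at (h : IsGrading D p n) (u : expGroup n) :
    ∃ s : n → n, ContDiffAt ℝ ∞ s (aff h u 0) ∧
    ∀ᶠ Z in 𝓝 (aff h u 0), aff h (u * expN (s Z)) 0 = Z := by
  obtain ⟨s, hs, hs'⟩ := exists_local_section h
  have e : aff h u⁻¹ (aff h u 0) = 0 := by rw [← aff_mul, inv_mul_cancel, aff_one]
  refine ⟨s ∘ aff h u⁻¹, ?_, ?_⟩
  · exact ContDiffAt.comp _ (by rwa [e]) (contDiff_aff h u⁻¹).contDiffAt
  · have hc : Filter.Tendsto (aff h u⁻¹) (𝓝 (aff h u 0)) (𝓝 0) := by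
      have := (contDiff_aff h u⁻¹).continuous.tendsto (aff h u 0)
      rwa [e] at this
    filter_upwards [hc.eventually hs'] with Z hZ
    rw [aff_mul]
    change aff h u (orbitMap h _) = Z
    rw [Function.comp, hZ, ← aff_mul, mul_inv_cancel, aff_one]

lemma isOpen_affOrbit (h : IsGrading D p n) : IsOpen (affOrbit h) := by
  rw [isOpen_iff_mem_nhds]
  rintro _ ⟨u, rfl⟩
  obtain ⟨s, -, hs⟩ := exists_local_section_at h u
  filter_upwards [hs] with Z hZ
  exact ⟨_, hZ⟩

/-- By freeness, `orbitSection` must agree near `aff h u 0` with the smooth family `u * expN (s Z)`,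
although it was defined pointwise by choice. -/
lemma contDiffAt_actN_orbitSection (h : IsGrading D p n) {Z : n} (hZ : Z ∈ affOrbit h) :
    ContDiffAt ℝ ∞ (fun Z => actN n h (orbitSection h Z)) Z ∧
    ContDiffAt ℝ ∞ (fun Z => actN n h (orbitSection h Z)⁻¹) Z := by
  obtain ⟨u, rfl⟩ := hZ
  obtain ⟨s, hs, hs'⟩ := exists_local_section_at h u
  let π : g →L[ℝ] n := LinearMap.toContinuousLinearMap (n.projectionOnto p h.isCompl.symm)
  -- The projection replaces the restriction of codomain by a composition, which preserves
  -- smoothness in `w`.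
  have hπ : ∀ w : expGroup n, actN n h w = (π.comp (act (w : Inn g))).comp n.subtypeL := fun w => by
    ext1 x
    exact (Submodule.projectionOnto_apply_left h.isCompl.symm (actN n h w x)).symm
  have hsec : ∀ᶠ Z in 𝓝 (aff h u 0), orbitSection h Z = u * expN (s Z) := by
    filter_upwards [hs'] with Z hZ
    conv_lhs => rw [← hZ]
    exact orbitSection_aff h _
  have hE : ContDiffAt ℝ ∞ (fun Z => NormedSpace.exp (adL (s Z : g))) (aff h u 0) :=
    (contDiff_expAd n).contDiffAt.comp _ hs
  have hE' : ContDiffAt ℝ ∞ (fun Z => NormedSpace.exp (adL ((-s Z : n) : g))) (aff h u 0) :=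
    (contDiff_expAd n).contDiffAt.comp _ hs.neg
  constructor
  · have : ContDiffAt ℝ ∞ (fun Z => (π.comp ((act (u : Inn g)).comp
        (NormedSpace.exp (adL (s Z : g))))).comp n.subtypeL) (aff h u 0) :=
      (contDiffAt_const.clm_comp (contDiffAt_const.clm_comp hE)).clm_comp contDiffAt_const
    refine this.congr_of_eventuallyEq ?_
    filter_upwards [hsec] with Z hZ
    rw [hZ, hπ]; rfl
  · have : ContDiffAt ℝ ∞ (fun Z => (π.comp ((NormedSpace.exp (adL ((-s Z : n) : g))).comp
        (act (u : Inn g)⁻¹))).comp n.subtypeL) (aff h u 0) :=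
      (contDiffAt_const.clm_comp (hE'.clm_comp contDiffAt_const)).clm_comp contDiffAt_const
    refine this.congr_of_eventuallyEq ?_
    filter_upwards [hsec] with Z hZ
    have e : (expN (s Z))⁻¹ = expN (-s Z) := Subtype.ext (inv_expAd _)
    rw [hZ, hπ, mul_inv_rev, e]; rfl

lemma zero_mem_affOrbit (h : IsGrading D p n) : (0 : n) ∈ affOrbit h := ⟨1, aff_one h 0⟩

/-- The coordinate expression of the invariant vector field. -/
def coordField (h : IsGrading D p n) (X Z : n) : n := actN n h (orbitSection h Z) (lieDEquiv h X)

lemma contDiffAt_coordField (h : IsGrading D p n) (X : n) {Z : n} (hZ : Z ∈ affOrbit h) :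
    ContDiffAt ℝ ∞ (coordField h X) Z :=
  (contDiffAt_actN_orbitSection h hZ).1.clm_apply contDiffAt_const

lemma coordField_zero (h : IsGrading D p n) (X : n) : coordField h X 0 = lieDEquiv h X := by
  have h1 := orbitSection_aff h 1
  rw [aff_one] at h1
  rw [coordField, h1, actN_one]

/-- Along the orbit map the field is explicitly `e^(ad X) [Y, D]`. Differentiating this composite at
0 in two ways gives the claim without differentiating the section. -/
lemma fderiv_coordField (h : IsGrading D p n) (X Y : n) :
    (fderiv ℝ (coordField h Y) 0 (lieDEquiv h X) : g) = ⁅(X : g), ⁅(Y : g), D⁆⁆ := by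
  have h1 : HasFDerivAt (coordField h Y) (fderiv ℝ (coordField h Y) 0) (orbitMap h 0) := by
    rw [orbitMap_zero]
    exact ((contDiffAt_coordField h Y (zero_mem_affOrbit h)).differentiableAt (by simp)).hasFDerivAt
  have h2 := n.subtypeL.hasFDerivAt.comp 0 (h1.comp 0 (hasStrictFDerivAt_orbitMap h).hasFDerivAt)
  have h3 := (hasStrictFDerivAt_expAd n).hasFDerivAt.clm_apply
    (hasFDerivAt_const (⁅(Y : g), D⁆) (0 : n))
  have h4 : (n.subtypeL ∘ coordField h Y ∘ orbitMap h) =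
      fun X : n => NormedSpace.exp (adL (X : g)) ⁅(Y : g), D⁆ := by
    ext X
    have : orbitSection h (orbitMap h X) = expN X := orbitSection_aff h _
    simp only [Function.comp, coordField, this]
    rfl
  rw [h4] at h2
  have h5 := congrArg (fun L => L X) (h2.unique h3)
  simpa using h5

/-- The Jacobi identity: `[X, [Y, D]] - [Y, [X, D]] = [[X, Y], D]`. -/
lemma lieBracket_coordField (h : IsGrading D p n) (X Y : n) :
    VectorField.lieBracket ℝ (coordField h X) (coordField h Y) 0 =
      lieDEquiv h ⟨⁅(X : g), (Y : g)⁆, Homog.lie_mem_n h X.2 Y.2⟩ := by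
  apply Subtype.ext
  rw [VectorField.lieBracket, coordField_zero, coordField_zero, Submodule.coe_sub,
    fderiv_coordField, fderiv_coordField, coe_lieDEquiv, lie_lie]

end LocalSection

/-! ### Vector fields and one-forms in charts, and Cartan's formula. -/

section Courant

variable {E : Type*} [NormedAddCommGroup E] [NormedSpace ℝ E]
  {M : Type*} [TopologicalSpace M] [ChartedSpace E M]

/-- The coordinate expression of a one-form in the chart `e`. -/
def formRep (e : OpenPartialHomeomorph M E) (η : Π x : M, TangentSpace 𝓘(ℝ, E) x →L[ℝ] ℝ) (y : E) :
    E →L[ℝ] ℝ :=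
  (η (e.symm y)).comp (mfderiv 𝓘(ℝ, E) 𝓘(ℝ, E) e.symm y)

variable {e e' : OpenPartialHomeomorph M E}

lemma mdifferentiable_of_mem_maximalAtlas (he : e ∈ IsManifold.maximalAtlas 𝓘(ℝ, E) ∞ M) :
    e.MDifferentiable 𝓘(ℝ, E) 𝓘(ℝ, E) :=
  ⟨(contMDiffOn_of_mem_maximalAtlas he).mdifferentiableOn (by simp),
    (contMDiffOn_symm_of_mem_maximalAtlas he).mdifferentiableOn (by simp)⟩

lemma contDiffAt_transition (he : e ∈ IsManifold.maximalAtlas 𝓘(ℝ, E) ∞ M)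
    (he' : e' ∈ IsManifold.maximalAtlas 𝓘(ℝ, E) ∞ M) {y : E} (hy : y ∈ e.target)
    (hy' : e.symm y ∈ e'.source) : ContDiffAt ℝ ∞ (e' ∘ e.symm) y := by
  rw [← contMDiffAt_iff_contDiffAt]
  exact ((contMDiffOn_of_mem_maximalAtlas he').contMDiffAt (e'.open_source.mem_nhds hy')).comp y
    ((contMDiffOn_symm_of_mem_maximalAtlas he).contMDiffAt (e.open_target.mem_nhds hy))

/-- The chain rule for `e.symm = e'.symm ∘ (e' ∘ e.symm)`, valid near `y`. -/
lemma formRep_eq_comp (he : e ∈ IsManifold.maximalAtlas 𝓘(ℝ, E) ∞ M)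
    (he' : e' ∈ IsManifold.maximalAtlas 𝓘(ℝ, E) ∞ M)
    (η : Π x : M, TangentSpace 𝓘(ℝ, E) x →L[ℝ] ℝ) {y : E} (hy : y ∈ e.target)
    (hy' : e.symm y ∈ e'.source) :
    formRep e η y = (formRep e' η ((e' ∘ e.symm) y)).comp (fderiv ℝ (e' ∘ e.symm) y) := by
  have hopen : ∀ᶠ z in 𝓝 y, e.symm z ∈ e'.source :=
    (e.symm.continuousAt hy).eventually (e'.open_source.mem_nhds hy')
  have h1 : e.symm =ᶠ[𝓝 y] e'.symm ∘ (e' ∘ e.symm) := by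
    filter_upwards [hopen] with z hz
    exact (e'.left_inv hz).symm
  -- All tangent spaces are `E` by definition. Typing the derivatives and the form over `E` lets
  -- base points be rewritten without dependent-type obstructions; the same device recurs below.
  let A : E →L[ℝ] E := mfderiv 𝓘(ℝ, E) 𝓘(ℝ, E) e.symm y
  let A' : E →L[ℝ] E := mfderiv 𝓘(ℝ, E) 𝓘(ℝ, E) e'.symm ((e' ∘ e.symm) y)
  let T : E →L[ℝ] E := mfderiv 𝓘(ℝ, E) 𝓘(ℝ, E) (e' ∘ e.symm) y
  have h2 : A = A'.comp T := by
    have h3 := mfderiv_comp (I := 𝓘(ℝ, E)) (I' := 𝓘(ℝ, E)) (I'' := 𝓘(ℝ, E)) y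
      ((mdifferentiable_of_mem_maximalAtlas he').mdifferentiableAt_symm
        (e'.map_source hy' : (e' ∘ e.symm) y ∈ e'.target))
      ((contDiffAt_transition he he' hy hy').contMDiffAt.mdifferentiableAt (by simp))
    rw [← h1.mfderiv_eq] at h3
    exact h3
  let ηE : M → E →L[ℝ] ℝ := η
  have h4 : ηE (e.symm y) = ηE (e'.symm ((e' ∘ e.symm) y)) := by
    rw [Function.comp, e'.left_inv hy']
  have h5 : T = fderiv ℝ (e' ∘ e.symm) y := mfderiv_eq_fderiv
  change (ηE (e.symm y)).comp A = ((ηE (e'.symm ((e' ∘ e.symm) y))).comp A').comp _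
  rw [h2, h4, ← h5]
  rfl

/-- Smoothness of the coordinate expression of a one-form does not depend on the chart. -/
lemma contDiffAt_formRep_of_chart (he : e ∈ IsManifold.maximalAtlas 𝓘(ℝ, E) ∞ M)
    (he' : e' ∈ IsManifold.maximalAtlas 𝓘(ℝ, E) ∞ M)
    {η : Π x : M, TangentSpace 𝓘(ℝ, E) x →L[ℝ] ℝ} {x : M} (hx : x ∈ e.source)
    (hx' : x ∈ e'.source) (hη : ContDiffAt ℝ ∞ (formRep e' η) (e' x)) :
    ContDiffAt ℝ ∞ (formRep e η) (e x) := by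
  have hy : e x ∈ e.target := e.map_source hx
  have hy' : e.symm (e x) ∈ e'.source := by rwa [e.left_inv hx]
  have hτ := contDiffAt_transition he he' hy hy'
  have hη' : ContDiffAt ℝ ∞ (formRep e' η) ((e' ∘ e.symm) (e x)) := by
    rwa [Function.comp, e.left_inv hx]
  refine ((hη'.comp (e x) hτ).clm_comp (hτ.fderiv_right (m := ∞) (by simp))).congr_of_eventuallyEq ?_
  filter_upwards [e.open_target.mem_nhds hy,
    (e.symm.continuousAt hy).eventually (e'.open_source.mem_nhds hy')] with z hz hz'
  exact formRep_eq_comp he he' η hz hz'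

/-- The derivative of `e.symm` is invertible on the target, so the inverse in the definition of
`mpullback` moves to the other side. -/
lemma mpullback_symm_eq_iff (he : e ∈ IsManifold.maximalAtlas 𝓘(ℝ, E) ∞ M)
    {V : Π x : M, TangentSpace 𝓘(ℝ, E) x} {v : E} {Z : E} (hZ : Z ∈ e.target) :
    VectorField.mpullback 𝓘(ℝ, E) 𝓘(ℝ, E) e.symm V Z = v ↔
      V (e.symm Z) = mfderiv 𝓘(ℝ, E) 𝓘(ℝ, E) e.symm Z v := by
  have hd := mdifferentiable_of_mem_maximalAtlas he
  rw [VectorField.mpullback_apply]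
  have : mfderiv 𝓘(ℝ, E) 𝓘(ℝ, E) e.symm Z = (hd.symm.mfderiv hZ : _ →L[ℝ] _) := rfl
  rw [this, ContinuousLinearMap.inverse_equiv]
  exact (hd.symm.mfderiv hZ).symm_apply_eq

lemma mlieBracket_eq_lieBracket (V W : Π x : E, TangentSpace 𝓘(ℝ, E) x) :
    VectorField.mlieBracket 𝓘(ℝ, E) V W = VectorField.lieBracket ℝ V W := by
  rw [← VectorField.mlieBracketWithin_univ, VectorField.mlieBracketWithin_eq_lieBracketWithin]
  exact VectorField.lieBracketWithin_univ

variable [IsManifold 𝓘(ℝ, E) ∞ M]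

/-- A one-form is smooth if its coordinate expression is. -/
lemma contMDiffAt_form_of_formRep (he : e ∈ IsManifold.maximalAtlas 𝓘(ℝ, E) ∞ M)
    {η : Π x : M, TangentSpace 𝓘(ℝ, E) x →L[ℝ] ℝ} {x : M} (hx : x ∈ e.source)
    (hη : ContDiffAt ℝ ∞ (formRep e η) (e x)) :
    ContMDiffAt 𝓘(ℝ, E) (𝓘(ℝ, E).prod 𝓘(ℝ, E →L[ℝ] ℝ)) ∞
      (fun x => (⟨x, η x⟩ : Bundle.TotalSpace (E →L[ℝ] ℝ)
        (fun x : M => TangentSpace 𝓘(ℝ, E) x →L[ℝ] Bundle.Trivial M ℝ x))) x := by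
  rw [contMDiffAt_hom_bundle]
  refine ⟨contMDiffAt_id, ?_⟩
  have h0 := contDiffAt_formRep_of_chart (IsManifold.chart_mem_maximalAtlas x) he
    (mem_chart_source E x) hx hη
  have h1 : ContMDiffAt 𝓘(ℝ, E) 𝓘(ℝ, E →L[ℝ] ℝ) ∞
      (formRep (chartAt E x) η ∘ chartAt E x) x :=
    h0.contMDiffAt.comp x ((contMDiffOn_of_mem_maximalAtlas
      (IsManifold.chart_mem_maximalAtlas x)).contMDiffAt
        ((chartAt E x).open_source.mem_nhds (mem_chart_source E x)))
  -- In the bundle trivialization at `x`, a form is composed with the derivative of the inverse of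
  -- `chartAt E x`, and that is `formRep`.
  refine h1.congr_of_eventuallyEq ?_
  filter_upwards [(chartAt E x).open_source.mem_nhds (mem_chart_source E x)] with z hz
  let ηE : M → E →L[ℝ] ℝ := η
  have h2 := TangentBundle.symmL_trivializationAt (I := 𝓘(ℝ, E)) hz
  simp only [ContinuousLinearMap.inCoordinates]
  rw [h2]
  have h3 : ηE ((chartAt E x).symm (chartAt E x z)) = ηE z := by rw [(chartAt E x).left_inv hz]
  change _ = ContinuousLinearMap.comp (M₁ := E) (M₂ := E)
    (ηE ((chartAt E x).symm (chartAt E x z))) _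
  rw [h3, modelWithCornersSelf_coe, Set.range_id, mfderivWithin_univ]
  ext v
  simp
  rfl

/-- A vector field is smooth if its coordinate expression is. -/
lemma contMDiffAt_vec_of_coord [CompleteSpace E] (he : e ∈ IsManifold.maximalAtlas 𝓘(ℝ, E) ∞ M)
    {V : Π x : M, TangentSpace 𝓘(ℝ, E) x} {w : E → E} {x : M} (hx : x ∈ e.source)
    (hw : ContDiffAt ℝ ∞ w (e x)) (hV : ∀ᶠ Z in 𝓝 (e x),
      V (e.symm Z) = mfderiv 𝓘(ℝ, E) 𝓘(ℝ, E) e.symm Z (w Z)) :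
    ContMDiffAt 𝓘(ℝ, E) (𝓘(ℝ, E).prod 𝓘(ℝ, E)) ∞
      (fun x => (⟨x, V x⟩ : TangentBundle 𝓘(ℝ, E) M)) x := by
  have hd := mdifferentiable_of_mem_maximalAtlas he
  -- Near `x` the field `V` is the pullback of `w` by the chart, and pullback by a local
  -- diffeomorphism preserves smoothness.
  have h1 := ContMDiffAt.mpullback_vectorField_preimage (I := 𝓘(ℝ, E)) (I' := 𝓘(ℝ, E)) (f := e)
    (x₀ := x) (V := w) (m := ∞) (n := ∞) (contMDiffAt_vectorSpace_iff_contDiffAt.2 hw)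
    ((contMDiffOn_of_mem_maximalAtlas he).contMDiffAt (e.open_source.mem_nhds hx))
    ⟨hd.mfderiv hx, rfl⟩ (by simp)
  refine h1.congr_of_eventuallyEq ?_
  filter_upwards [e.open_source.mem_nhds hx, (e.continuousAt hx).eventually hV] with z hz hz'
  let VE : M → E := V
  have h2 : VE (e.symm (e z)) = VE z := by rw [e.left_inv hz]
  have h3 : (mfderiv 𝓘(ℝ, E) 𝓘(ℝ, E) e z).inverse = mfderiv 𝓘(ℝ, E) 𝓘(ℝ, E) e.symm (e z) := by
    have : mfderiv 𝓘(ℝ, E) 𝓘(ℝ, E) e z = (hd.mfderiv hz : _ →L[ℝ] _) := rfl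
    rw [this, ContinuousLinearMap.inverse_equiv]
    rfl
  have h4 : VE z = VectorField.mpullback 𝓘(ℝ, E) 𝓘(ℝ, E) e w z := by
    change VE z = (mfderiv 𝓘(ℝ, E) 𝓘(ℝ, E) e z).inverse (w (e z))
    rw [h3]
    exact h2.symm.trans hz'
  exact congrArg (fun v => (⟨z, v⟩ : TangentBundle 𝓘(ℝ, E) M)) h4

/-- Cartan's formula for `(L_V η)(W)` when `η(W)` is constant. -/
lemma lieDerivForm_apply_of_const [CompleteSpace E] {V W : Π x : M, TangentSpace 𝓘(ℝ, E) x}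
    {η : Π x : M, TangentSpace 𝓘(ℝ, E) x →L[ℝ] ℝ} {x : M} {c : ℝ}
    (hV : MDifferentiableAt 𝓘(ℝ, E) (𝓘(ℝ, E).prod 𝓘(ℝ, E))
      (fun x => (⟨x, V x⟩ : TangentBundle 𝓘(ℝ, E) M)) x)
    (hW : MDifferentiableAt 𝓘(ℝ, E) (𝓘(ℝ, E).prod 𝓘(ℝ, E))
      (fun x => (⟨x, W x⟩ : TangentBundle 𝓘(ℝ, E) M)) x)
    (hη : DifferentiableAt ℝ (formRep (chartAt E x) η) (chartAt E x x))
    (hc : ∀ᶠ y in 𝓝 x, η y (W y) = c) :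
    lieDerivForm V η x (W x) = -η x (VectorField.mlieBracket 𝓘(ℝ, E) V W x) := by
  have : IsManifold 𝓘(ℝ, E) 2 M := inferInstance
  have : IsManifold 𝓘(ℝ, E) 1 M := IsManifold.of_le (n := ∞) (by simp)
  set e := chartAt E x with he
  have hd : e.MDifferentiable 𝓘(ℝ, E) 𝓘(ℝ, E) := mdifferentiable_chart x
  have hx : x ∈ e.source := mem_chart_source E x
  let V' : E → E := VectorField.mpullback 𝓘(ℝ, E) 𝓘(ℝ, E) e.symm V
  let W' : E → E := VectorField.mpullback 𝓘(ℝ, E) 𝓘(ℝ, E) e.symm W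
  have hpull : ∀ U : Π x : M, TangentSpace 𝓘(ℝ, E) x,
      VectorField.mpullbackWithin 𝓘(ℝ, E) 𝓘(ℝ, E) (extChartAt 𝓘(ℝ, E) x).symm U
        (Set.range 𝓘(ℝ, E)) = VectorField.mpullback 𝓘(ℝ, E) 𝓘(ℝ, E) e.symm U := fun U => by
    rw [modelWithCornersSelf_coe, Set.range_id, VectorField.mpullbackWithin_univ]; rfl
  have hV' : DifferentiableAt ℝ V' (e x) := by
    have h1 := MDifferentiableWithinAt.differentiableWithinAt_mpullbackWithin_vectorField
      (mdifferentiableWithinAt_univ.2 hV)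
    rw [hpull] at h1
    rw [modelWithCornersSelf_coe, Set.range_id, Set.preimage_univ, Set.inter_univ] at h1
    exact differentiableWithinAt_univ.1 h1
  have hW' : DifferentiableAt ℝ W' (e x) := by
    have h1 := MDifferentiableWithinAt.differentiableWithinAt_mpullbackWithin_vectorField
      (mdifferentiableWithinAt_univ.2 hW)
    rw [hpull] at h1
    rw [modelWithCornersSelf_coe, Set.range_id, Set.preimage_univ, Set.inter_univ] at h1
    exact differentiableWithinAt_univ.1 h1
  -- The tangent space at `x` is identified with `E` through the preferred chart at `x`, so that
  -- chart has identity derivative there.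
  have hid : mfderiv 𝓘(ℝ, E) 𝓘(ℝ, E) e x = ContinuousLinearMap.id ℝ E := mfderiv_extChartAt_self
  have hbr : (VectorField.mlieBracket 𝓘(ℝ, E) V W x : E) =
      VectorField.lieBracket ℝ V' W' (e x) := by
    rw [← VectorField.mlieBracketWithin_univ, VectorField.mlieBracketWithin_apply, hpull, hpull]
    have : mfderiv 𝓘(ℝ, E) 𝓘(ℝ, E) (extChartAt 𝓘(ℝ, E) x) x = ContinuousLinearMap.id ℝ E := hid
    rw [this]
    rw [Set.preimage_univ, modelWithCornersSelf_coe, Set.range_id, Set.inter_univ]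
    change (ContinuousLinearMap.id ℝ E).inverse
      (VectorField.lieBracketWithin ℝ V' W' Set.univ (e x)) = _
    rw [ContinuousLinearMap.inverse_id, VectorField.lieBracketWithin_univ]
    rfl
  let A : E →L[ℝ] E := mfderiv 𝓘(ℝ, E) 𝓘(ℝ, E) e.symm (e x)
  have hidsymm : A = ContinuousLinearMap.id ℝ E := by
    have h1 := hd.symm_comp_deriv hx
    rw [hid] at h1
    exact h1
  let ηE : M → E →L[ℝ] ℝ := η
  let WE : M → E := W
  have hηx : formRep e η (e x) = ηE x := by
    have : ηE (e.symm (e x)) = ηE x := by rw [e.left_inv hx]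
    rw [← this]
    change (ηE (e.symm (e x))).comp A = _
    rw [hidsymm]; rfl
  have hWx : W' (e x) = WE x := by
    have : WE (e.symm (e x)) = WE x := by rw [e.left_inv hx]
    rw [← this]
    change A.inverse (WE (e.symm (e x))) = _
    rw [hidsymm, ContinuousLinearMap.inverse_id]; rfl
  -- The derivative of `e.symm` in `formRep` cancels its inverse in `W'`, so the pairing does not
  -- depend on coordinates.
  have hconst : (fun y => formRep e η y (W' y)) =ᶠ[𝓝 (e x)] fun _ => c := by
    have ht : Filter.Tendsto e.symm (𝓝 (e x)) (𝓝 x) := by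
      have := (e.symm.continuousAt (e.map_source hx)).tendsto
      rwa [e.left_inv hx] at this
    filter_upwards [e.open_target.mem_nhds (e.map_source hx), ht.eventually hc] with y hy hy'
    rw [← hy']
    let F : TangentSpace 𝓘(ℝ, E) y ≃L[ℝ] TangentSpace 𝓘(ℝ, E) (e.symm y) := hd.symm.mfderiv hy
    change η (e.symm y) (F ((F : TangentSpace 𝓘(ℝ, E) y →L[ℝ]
      TangentSpace 𝓘(ℝ, E) (e.symm y)).inverse (W (e.symm y)))) = _
    rw [ContinuousLinearMap.inverse_equiv]
    exact congrArg (η (e.symm y)) (F.apply_symm_apply _)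
  -- Differentiating the constant along `V'` gives `Dη(V')(W') + η(DW'(V')) = 0`. This trades the
  -- first term of the Lie derivative for `-η(DW'(V'))`, and the bracket `DW'(V') - DV'(W')`
  -- appears.
  have h1 := (hη.hasFDerivAt.clm_apply hW'.hasFDerivAt).unique
    (hconst.symm.hasFDerivAt_iff.1 (hasFDerivAt_const c (e x)))
  have h2 := congrArg (fun L : E →L[ℝ] ℝ => L (V' (e x))) h1
  simp only [add_apply, ContinuousLinearMap.comp_apply,
    ContinuousLinearMap.flip_apply, zero_apply] at h2
  have h3 : lieDerivForm V η x (W x) =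
      fderiv ℝ (formRep e η) (e x) (V' (e x)) (W' (e x)) +
        formRep e η (e x) (fderiv ℝ V' (e x) (W' (e x))) := by
    rw [hWx]
    have h4 : mfderiv 𝓘(ℝ, E) 𝓘(ℝ, E) (extChartAt 𝓘(ℝ, E) x) x = ContinuousLinearMap.id ℝ E := hid
    unfold lieDerivForm
    simp only
    rw [h4]
    rfl
  have h5 : η x (VectorField.mlieBracket 𝓘(ℝ, E) V W x) =
      formRep e η (e x) (VectorField.lieBracket ℝ V' W' (e x)) := by
    rw [hηx, ← hbr]
    rfl
  rw [h3, h5, VectorField.lieBracket, map_sub]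
  linarith

end Courant

/-! ### The group generated by `e^(ad n)` in the chart of the homogeneous space. -/

namespace Homog

variable {g : Type*} [LieRing g] [LieAlgebra ℝ g] [FiniteDimensional ℝ g]
  {D : g} {p n : Submodule ℝ g}

lemma chart_one_symm (h : IsGrading D p n) (Z : n) : (chart h 1).symm Z = mk p (conj h Z) :=
  one_smul (Inn g) (mk p (conj h Z))

/-- A conjugate transversal to `n` is determined by its element of `D + n`. Since `u` preserves `n`,
it preserves transversality, and it carries `D + Z` to `D + aff h u Z`. -/
lemma smul_chart_symm (h : IsGrading D p n) (u : expGroup n) (Z : n) :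
    (u : Inn g) • (chart h 1).symm Z = (chart h 1).symm (aff h u Z) := by
  rw [chart_one_symm, chart_one_symm]
  apply eq_conj h
  · rw [eq_bot_iff, sub_smul]
    rintro _ ⟨⟨x, hx, rfl⟩, hxn⟩
    have h1 : x ∈ n := by
      have := act_mem_of_mem_expGroup h (inv_mem u.2) hxn
      rwa [ContinuousLinearMap.coe_coe, act_inv_act] at this
    have : x ∈ sub (mk p (conj h Z)) ⊓ n := ⟨hx, h1⟩
    rw [sub_conj_inf h Z, Submodule.mem_bot] at this
    simp [this]
  · rw [sub_smul, add_aff]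
    exact ⟨_, mem_sub_conj h Z, rfl⟩

lemma chart_symm_zero (h : IsGrading D p n) : (chart h 1).symm (0 : n) = mk p 1 := by
  rw [chart_one_symm]
  have h1 : sub (mk p (1 : Inn g)) = p := by rw [sub_mk]; ext x; simp [act_one]
  refine (eq_conj h ?_ ?_).symm
  · rw [h1]; exact h.isCompl.inf_eq_bot
  · rw [h1, Submodule.coe_zero, add_zero]; exact h.D_mem

end Homog

/-! ### Orthogonality of eigenspaces under the Killing form. -/

section KillingForm

lemma eq_zero_of_killingForm {g : Type*} [LieRing g] [LieAlgebra ℝ g] [LieAlgebra.IsKilling ℝ g] {x : g} (hx : ∀ y, killingForm ℝ g x y = 0) : x = 0 := by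
  have h1 : x ∈ LinearMap.ker (killingForm ℝ g) := LinearMap.ext hx
  rwa [LieAlgebra.IsKilling.ker_killingForm_eq_bot, Submodule.mem_bot] at h1

variable {g : Type*} [LieRing g] [LieAlgebra ℝ g] [FiniteDimensional ℝ g]

/-- Invariance moves `ad D` from one argument to the other, so the value is multiplied by `-a` on
one side and by `b` on the other. -/
lemma killingForm_eig {D x y : g} {a b : ℝ} (hx : x ∈ eig D a) (hy : y ∈ eig D b)
    (hab : a + b ≠ 0) : killingForm ℝ g x y = 0 := by
  have h1 := LieModule.traceForm_apply_lie_apply ℝ g g x D y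
  have h2 : ⁅x, D⁆ = -(a • x) := by rw [← lie_skew, mem_eig.1 hx]
  rw [h2, mem_eig.1 hy] at h1
  have h3 : -(a * killingForm ℝ g x y) = b * killingForm ℝ g x y := by
    simpa using h1
  have h4 : (a + b) * killingForm ℝ g x y = 0 := by linarith
  exact (mul_eq_zero.1 h4).resolve_left hab

lemma killingForm_iSup_eig {ι κ : Type*} {D x y : g} {a : ι → ℝ} {b : κ → ℝ}
    (hx : x ∈ ⨆ i, eig D (a i)) (hy : y ∈ ⨆ k, eig D (b k)) (hab : ∀ i k, a i + b k ≠ 0) :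
    killingForm ℝ g x y = 0 := by
  induction hx using Submodule.iSup_induction' with
  | zero => simp
  | add x x' _ _ h h' => rw [map_add, LinearMap.add_apply, h, h', add_zero]
  | mem i x hx =>
    induction hy using Submodule.iSup_induction' with
    | zero => simp
    | add y y' _ _ h h' => rw [map_add, h, h', add_zero]
    | mem k y hy => exact killingForm_eig hx hy (hab i k)

end KillingForm

/-! ### The open cell of the flag manifold and the translations on it. -/

section Flag

open LieAlgebra LieAlgebra.IsKilling Module

variable {g : Type*} [LieRing g] [LieAlgebra ℝ g] [FiniteDimensional ℝ g] [LieAlgebra.IsKilling ℝ g]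
  {H : LieSubalgebra ℝ g} [H.IsCartanSubalgebra] [LieModule.IsTriangularizable ℝ H g]
  (B : (rootSystem H).Base) (Θ : Set B.support)

namespace FlagManifold

/-- The chart of the flag manifold on the set of conjugates of `p_Θ` transversal to `n_Θ⁻`. -/
def cellChart : OpenPartialHomeomorph (FlagManifold B Θ) (nMinus B Θ) :=
  (Homog.core (isGrading B Θ)).openPartialHomeomorph (Homog.chart (isGrading B Θ) 1) ⟨1, rfl⟩

lemma cellChart_mem_maximalAtlas :
    cellChart B Θ ∈ IsManifold.maximalAtlas 𝓘(ℝ, nMinus B Θ) ∞ (FlagManifold B Θ) := by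
  apply StructureGroupoid.subset_maximalAtlas
  exact Set.mem_iUnion₂.2 ⟨Homog.chart (isGrading B Θ) 1, ⟨1, rfl⟩, rfl⟩

lemma mem_cellChart_target (Z : nMinus B Θ) : Z ∈ (cellChart B Θ).target := Set.mem_univ Z

/-- The inverse of the chart, as a parametrization of the cell. -/
def param (Z : nMinus B Θ) : FlagManifold B Θ := (cellChart B Θ).symm Z

lemma param_mem_source (Z : nMinus B Θ) : param B Θ Z ∈ (cellChart B Θ).source :=
  (cellChart B Θ).map_target (mem_cellChart_target B Θ Z)

lemma cellChart_param (Z : nMinus B Θ) : cellChart B Θ (param B Θ Z) = Z :=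
  (cellChart B Θ).right_inv (mem_cellChart_target B Θ Z)

lemma param_zero : param B Θ 0 = origin B Θ := Homog.chart_symm_zero (isGrading B Θ)

lemma smul_param (u : expGroup (nMinus B Θ)) (Z : nMinus B Θ) :
    (u : Inn g) • param B Θ Z = param B Θ (aff (isGrading B Θ) u Z) :=
  Homog.smul_chart_symm (isGrading B Θ) u Z

lemma contMDiff_param : ContMDiff 𝓘(ℝ, nMinus B Θ) 𝓘(ℝ, nMinus B Θ) ∞ (param B Θ) := fun Z =>
  (contMDiffOn_symm_of_mem_maximalAtlas (cellChart_mem_maximalAtlas B Θ)).contMDiffAt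
    ((cellChart B Θ).open_target.mem_nhds (mem_cellChart_target B Θ Z))

/-- The derivative of the parametrization. -/
def dparam (Z : nMinus B Θ) :
    nMinus B Θ ≃L[ℝ] TangentSpace 𝓘(ℝ, nMinus B Θ) (param B Θ Z) :=
  (mdifferentiable_of_mem_maximalAtlas (cellChart_mem_maximalAtlas B Θ)).symm.mfderiv
    (mem_cellChart_target B Θ Z)

lemma hasMFDerivAt_param (Z : nMinus B Θ) :
    HasMFDerivAt 𝓘(ℝ, nMinus B Θ) 𝓘(ℝ, nMinus B Θ) (param B Θ) Z
      (dparam B Θ Z : nMinus B Θ →L[ℝ] TangentSpace 𝓘(ℝ, nMinus B Θ) (param B Θ Z)) :=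
  ((contMDiff_param B Θ).mdifferentiableAt (by simp)).hasMFDerivAt

lemma mem_openCell_iff {q : FlagManifold B Θ} :
    q ∈ openCell B Θ ↔ ∃ u : expGroup (nMinus B Θ), q = param B Θ (aff (isGrading B Θ) u 0) := by
  constructor
  · rintro ⟨u, hu, rfl⟩
    -- `NMinus B Θ` and `expGroup (nMinus B Θ)` unfold to the same closure.
    exact ⟨⟨u, hu⟩, by rw [← smul_param, param_zero]⟩
  · rintro ⟨u, rfl⟩
    exact ⟨u, u.2, by rw [← smul_param, param_zero]⟩

lemma param_mem_openCell {Z : nMinus B Θ} :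
    param B Θ Z ∈ openCell B Θ ↔ Z ∈ affOrbit (isGrading B Θ) := by
  rw [mem_openCell_iff]
  constructor
  · rintro ⟨u, hu⟩
    refine ⟨u, ?_⟩
    rw [← cellChart_param B Θ Z, hu, cellChart_param]
  · rintro ⟨u, rfl⟩
    exact ⟨u, rfl⟩

lemma exists_eq_aff {Z : nMinus B Θ} (hZ : Z ∈ affOrbit (isGrading B Θ)) :
    ∃ u : expGroup (nMinus B Θ), Z = aff (isGrading B Θ) u 0 := by
  obtain ⟨u, rfl⟩ := hZ
  exact ⟨u, rfl⟩

lemma aff_mem_affOrbit (u : expGroup (nMinus B Θ)) :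
    aff (isGrading B Θ) u 0 ∈ affOrbit (isGrading B Θ) := ⟨u, rfl⟩

lemma openCell_subset_source : openCell B Θ ⊆ (cellChart B Θ).source := fun q hq => by
  obtain ⟨u, rfl⟩ := (mem_openCell_iff B Θ).1 hq
  exact param_mem_source B Θ _

/-- The cell is the preimage of the open set `affOrbit` under the chart. -/
lemma isOpen_openCell : IsOpen (openCell B Θ) := by
  have h1 := (cellChart B Θ).isOpen_inter_preimage (isOpen_affOrbit (isGrading B Θ))
  convert h1 using 1
  ext q
  constructor
  · intro hq
    refine ⟨openCell_subset_source B Θ hq, ?_⟩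
    rw [Set.mem_preimage, ← param_mem_openCell, param,
      (cellChart B Θ).left_inv (openCell_subset_source B Θ hq)]
    exact hq
  · rintro ⟨hq, hq'⟩
    have := (param_mem_openCell B Θ).2 hq'
    rwa [param, (cellChart B Θ).left_inv hq] at this

lemma origin_mem_openCell : origin B Θ ∈ openCell B Θ :=
  ⟨1, one_mem _, one_smul _ _⟩

/-- In the chart the translation is `aff`, whose linear part is `actN`. Vectors are compared in
`nMinus B Θ` because the two sides live over different expressions of the same point. -/
lemma hasMFDerivAt_translate (u : expGroup (nMinus B Θ)) (Z : nMinus B Θ) :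
    ∃ L : TangentSpace 𝓘(ℝ, nMinus B Θ) (param B Θ Z) →L[ℝ]
        TangentSpace 𝓘(ℝ, nMinus B Θ) (translate B Θ u (param B Θ Z)),
      HasMFDerivAt 𝓘(ℝ, nMinus B Θ) 𝓘(ℝ, nMinus B Θ) (translate B Θ u) (param B Θ Z) L ∧
      ∀ v : nMinus B Θ, (L (dparam B Θ Z v) : nMinus B Θ) =
        dparam B Θ (aff (isGrading B Θ) u Z) (actN _ (isGrading B Θ) u v) := by
  have hs : translate B Θ u =ᶠ[𝓝 (param B Θ Z)]
      param B Θ ∘ aff (isGrading B Θ) u ∘ cellChart B Θ := by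
    filter_upwards [(cellChart B Θ).open_source.mem_nhds (param_mem_source B Θ Z)] with q hq
    conv_lhs => rw [← (cellChart B Θ).left_inv hq]
    exact smul_param B Θ u _
  have h1 : MDifferentiableAt 𝓘(ℝ, nMinus B Θ) 𝓘(ℝ, nMinus B Θ) (cellChart B Θ) (param B Θ Z) :=
    (mdifferentiable_of_mem_maximalAtlas (cellChart_mem_maximalAtlas B Θ)).mdifferentiableAt
      (param_mem_source B Θ Z)
  have h2 : MDifferentiableAt 𝓘(ℝ, nMinus B Θ) 𝓘(ℝ, nMinus B Θ) (translate B Θ u)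
      (param B Θ Z) := by
    refine MDifferentiableAt.congr_of_eventuallyEq ?_ hs
    refine ((contMDiff_param B Θ).mdifferentiableAt (by simp)).comp _ ?_
    exact ((contDiff_aff (isGrading B Θ) u).contMDiff.mdifferentiableAt (by simp)).comp _ h1
  refine ⟨_, h2.hasMFDerivAt, fun v => ?_⟩
  have h3 := h2.hasMFDerivAt.comp Z (hasMFDerivAt_param B Θ Z)
  have h4 := (hasMFDerivAt_param B Θ (aff (isGrading B Θ) u Z)).comp Z
    (hasFDerivAt_aff (isGrading B Θ) u Z).hasMFDerivAt
  have h5 : translate B Θ u ∘ param B Θ = param B Θ ∘ aff (isGrading B Θ) u :=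
    funext fun Z => smul_param B Θ u Z
  rw [← h5] at h4
  exact congrArg (fun L : nMinus B Θ →L[ℝ] nMinus B Θ => L v) (hasMFDerivAt_unique h3 h4)

lemma mdifferentiableAt_translate {u : Inn g} (hu : u ∈ NMinus B Θ) {q : FlagManifold B Θ}
    (hq : q ∈ openCell B Θ) :
    MDifferentiableAt 𝓘(ℝ, nMinus B Θ) 𝓘(ℝ, nMinus B Θ) (translate B Θ u) q := by
  obtain ⟨w, rfl⟩ := (mem_openCell_iff B Θ).1 hq
  obtain ⟨L, hL, -⟩ := hasMFDerivAt_translate B Θ ⟨u, hu⟩ (aff (isGrading B Θ) w 0)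
  exact hL.mdifferentiableAt

lemma mfderiv_translate_param (u : expGroup (nMinus B Θ)) (Z v : nMinus B Θ) :
    (mfderiv 𝓘(ℝ, nMinus B Θ) 𝓘(ℝ, nMinus B Θ) (translate B Θ u) (param B Θ Z)
      (dparam B Θ Z v) : nMinus B Θ) =
        dparam B Θ (aff (isGrading B Θ) u Z) (actN _ (isGrading B Θ) u v) := by
  obtain ⟨L, hL, hL'⟩ := hasMFDerivAt_translate B Θ u Z
  rw [hL.mfderiv]
  exact hL' v

/-- Freeness of the affine action, read through the chart; it makes the choice in `invariantExt`
harmless. -/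
lemma translate_injective {u v : Inn g} (hu : u ∈ NMinus B Θ) (hv : v ∈ NMinus B Θ)
    (huv : translate B Θ u (origin B Θ) = translate B Θ v (origin B Θ)) : u = v := by
  have h1 := smul_param B Θ ⟨u, hu⟩ 0
  have h2 := smul_param B Θ ⟨v, hv⟩ 0
  rw [param_zero] at h1 h2
  have h3 := congrArg (cellChart B Θ) (h1.symm.trans (huv.trans h2))
  rw [cellChart_param, cellChart_param] at h3
  exact congrArg Subtype.val (aff_zero_injective (isGrading B Θ) h3)

/-! ### Invariant extensions and the identification of the tangent space. -/

variable (v : TangentSpace 𝓘(ℝ, nMinus B Θ) (origin B Θ))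
  (ξ : TangentSpace 𝓘(ℝ, nMinus B Θ) (origin B Θ) →L[ℝ] ℝ)

lemma invariantExt_vec {u : Inn g} (hu : u ∈ NMinus B Θ) :
    (invariantExt B Θ v ξ).vec (translate B Θ u (origin B Θ)) =
      mfderiv 𝓘(ℝ, nMinus B Θ) 𝓘(ℝ, nMinus B Θ) (translate B Θ u) (origin B Θ) v := by
  have hq : translate B Θ u (origin B Θ) ∈ openCell B Θ := ⟨u, hu, rfl⟩
  have h1 : hq.choose = u := translate_injective B Θ hq.choose_spec.1 hu hq.choose_spec.2
  have h2 : (invariantExt B Θ v ξ).vec (translate B Θ u (origin B Θ)) =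
      (mfderiv 𝓘(ℝ, nMinus B Θ) 𝓘(ℝ, nMinus B Θ) (translate B Θ hq.choose) (origin B Θ) v :
        nMinus B Θ) := dif_pos hq
  rw [h2, h1]

lemma invariantExt_form {u : Inn g} (hu : u ∈ NMinus B Θ)
    (w : TangentSpace 𝓘(ℝ, nMinus B Θ) (translate B Θ u (origin B Θ))) :
    (invariantExt B Θ v ξ).form (translate B Θ u (origin B Θ)) w =
      ξ (mfderiv 𝓘(ℝ, nMinus B Θ) 𝓘(ℝ, nMinus B Θ) (translate B Θ u⁻¹)
        (translate B Θ u (origin B Θ)) w : nMinus B Θ) := by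
  have hq : translate B Θ u (origin B Θ) ∈ openCell B Θ := ⟨u, hu, rfl⟩
  have h1 : hq.choose = u := translate_injective B Θ hq.choose_spec.1 hu hq.choose_spec.2
  have h2 : (invariantExt B Θ v ξ).form (translate B Θ u (origin B Θ)) w =
      ξ (mfderiv 𝓘(ℝ, nMinus B Θ) 𝓘(ℝ, nMinus B Θ) (translate B Θ hq.choose⁻¹)
        (translate B Θ u (origin B Θ)) w : nMinus B Θ) :=
    congrArg (fun L : nMinus B Θ →L[ℝ] ℝ => L w) (dif_pos hq)
  rw [h2, h1]

/-- `tangentId` as a continuous linear equivalence. -/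
def tangentEquiv : nMinus B Θ ≃L[ℝ] TangentSpace 𝓘(ℝ, nMinus B Θ) (origin B Θ) :=
  (lieDEquiv (isGrading B Θ)).trans (dparam B Θ 0)

/-- In the chart, `X ↦ e^(ad X) b_Θ` is the orbit map, so this identification differs from the one
given by the chart by `X ↦ [X, D]`. -/
lemma tangentId_eq : tangentId B Θ = (tangentEquiv B Θ : nMinus B Θ →L[ℝ] _) := by
  have h1 : (fun X : nMinus B Θ => expAd (X : g) • origin B Θ) =
      param B Θ ∘ orbitMap (isGrading B Θ) := by
    funext X
    rw [← param_zero]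
    exact smul_param B Θ (expN X) 0
  have h2 := (hasStrictFDerivAt_orbitMap (isGrading B Θ)).hasFDerivAt.hasMFDerivAt
  have h3 := hasMFDerivAt_param B Θ (orbitMap (isGrading B Θ) 0)
  have h4 := h3.comp 0 h2
  unfold tangentId
  rw [h1]
  refine h4.mfderiv.trans ?_
  rw [orbitMap_zero]
  rfl

lemma tangentId_apply (X : nMinus B Θ) :
    (tangentId B Θ X : nMinus B Θ) = dparam B Θ 0 (lieDEquiv (isGrading B Θ) X) := by
  rw [tangentId_eq]; rfl

lemma tangentId_bijective : Function.Bijective (tangentId B Θ) := by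
  rw [tangentId_eq]
  exact (tangentEquiv B Θ).bijective

lemma cotangentId_tangentId (φ : Module.Dual ℝ g) (X : nMinus B Θ) :
    cotangentId B Θ φ (tangentId B Θ X) = φ X := by
  unfold cotangentId
  rw [tangentId_eq, ContinuousLinearMap.inverse_equiv]
  exact congrArg (fun Y : nMinus B Θ => φ Y) ((tangentEquiv B Θ).symm_apply_apply X)

/-! ### Coordinates, smoothness and invariance of the sections `X + Z*`. -/

variable (X Y : nMinus B Θ) (Z W : nPlus B Θ)

lemma translate_origin (u : expGroup (nMinus B Θ)) :
    translate B Θ u (origin B Θ) = param B Θ (aff (isGrading B Θ) u 0) := by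
  rw [← param_zero]; exact smul_param B Θ u 0

lemma invariantField_vec_param {P : nMinus B Θ} (hP : P ∈ affOrbit (isGrading B Θ)) :
    ((invariantField B Θ X Z).vec (param B Θ P) : nMinus B Θ) =
      dparam B Θ P (coordField (isGrading B Θ) X P) := by
  obtain ⟨u, rfl⟩ := exists_eq_aff B Θ hP
  let V : FlagManifold B Θ → nMinus B Θ := (invariantField B Θ X Z).vec
  let T : FlagManifold B Θ → nMinus B Θ →L[ℝ] nMinus B Θ := fun q =>
    mfderiv 𝓘(ℝ, nMinus B Θ) 𝓘(ℝ, nMinus B Θ) (translate B Θ u) q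
  let t : nMinus B Θ := tangentId B Θ X
  have ht : t = dparam B Θ 0 (lieDEquiv (isGrading B Θ) X) := tangentId_apply B Θ X
  have h1 : V (translate B Θ u (origin B Θ)) = T (origin B Θ) t :=
    invariantExt_vec B Θ _ _ u.2
  rw [translate_origin, ← param_zero, ht] at h1
  refine h1.trans ((mfderiv_translate_param B Θ u 0 _).trans ?_)
  rw [coordField, orbitSection_aff]

lemma invariantField_form_param {P : nMinus B Θ} (hP : P ∈ affOrbit (isGrading B Θ))
    (w : nMinus B Θ) :
    (invariantField B Θ X Z).form (param B Θ P) (dparam B Θ P w) =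
      killingForm ℝ g (Z : g) ((lieDEquiv (isGrading B Θ)).symm
        (actN _ (isGrading B Θ) (orbitSection (isGrading B Θ) P)⁻¹ w) : nMinus B Θ) := by
  obtain ⟨u, rfl⟩ := exists_eq_aff B Θ hP
  let F : FlagManifold B Θ → nMinus B Θ →L[ℝ] ℝ := (invariantField B Θ X Z).form
  let T : FlagManifold B Θ → nMinus B Θ →L[ℝ] nMinus B Θ := fun q =>
    mfderiv 𝓘(ℝ, nMinus B Θ) 𝓘(ℝ, nMinus B Θ) (translate B Θ (u : Inn g)⁻¹) q
  let ξ : nMinus B Θ →L[ℝ] ℝ := cotangentId B Θ (killingForm ℝ g (Z : g))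
  have h1 : F (translate B Θ u (origin B Θ)) = ξ.comp (T (translate B Θ u (origin B Θ))) :=
    ContinuousLinearMap.ext fun w => invariantExt_form B Θ _ _ u.2 w
  rw [translate_origin] at h1
  refine (congrArg (fun L : nMinus B Θ →L[ℝ] ℝ =>
    L (dparam B Θ (aff (isGrading B Θ) u 0) w)) h1).trans ?_
  change ξ (T _ _) = _
  have h2 : T (param B Θ (aff (isGrading B Θ) u 0)) (dparam B Θ (aff (isGrading B Θ) u 0) w) =
    dparam B Θ (aff (isGrading B Θ) u⁻¹ (aff (isGrading B Θ) u 0))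
      (actN _ (isGrading B Θ) u⁻¹ w) := mfderiv_translate_param B Θ u⁻¹ _ w
  rw [h2, ← aff_mul, inv_mul_cancel, aff_one, orbitSection_aff, ← cotangentId_tangentId]
  have h3 := tangentId_apply B Θ
    ((lieDEquiv (isGrading B Θ)).symm (actN _ (isGrading B Θ) u⁻¹ w))
  rw [ContinuousLinearEquiv.apply_symm_apply] at h3
  exact congrArg ξ h3.symm

/-- The pairing of an invariant form with an invariant vector field is constant. -/
lemma invariantField_form_vec {q : FlagManifold B Θ} (hq : q ∈ openCell B Θ) :
    (invariantField B Θ X Z).form q ((invariantField B Θ Y W).vec q) =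
      killingForm ℝ g (Z : g) (Y : g) := by
  obtain ⟨u, rfl⟩ := (mem_openCell_iff B Θ).1 hq
  have hP : aff (isGrading B Θ) u 0 ∈ affOrbit (isGrading B Θ) := ⟨u, rfl⟩
  have h1 := invariantField_vec_param B Θ Y W hP
  refine (congrArg _ h1).trans ((invariantField_form_param B Θ X Z hP _).trans ?_)
  -- The field is pushed forward by the group element and the form is pulled back by its inverse, so
  -- both cancel in the pairing.
  rw [coordField, ← actN_mul, inv_mul_cancel, actN_one, ContinuousLinearEquiv.symm_apply_apply]

lemma eventually_mem_affOrbit {P : nMinus B Θ} (hP : P ∈ affOrbit (isGrading B Θ)) :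
    ∀ᶠ Q in 𝓝 P, Q ∈ affOrbit (isGrading B Θ) :=
  (isOpen_affOrbit (isGrading B Θ)).mem_nhds hP

lemma contMDiffAt_invariantField_vec {q : FlagManifold B Θ} (hq : q ∈ openCell B Θ) :
    ContMDiffAt 𝓘(ℝ, nMinus B Θ) (𝓘(ℝ, nMinus B Θ).prod 𝓘(ℝ, nMinus B Θ)) ∞
      (fun x => (⟨x, (invariantField B Θ X Z).vec x⟩ :
        TangentBundle 𝓘(ℝ, nMinus B Θ) (FlagManifold B Θ))) q := by
  obtain ⟨u, rfl⟩ := (mem_openCell_iff B Θ).1 hq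
  have hP : aff (isGrading B Θ) u 0 ∈ affOrbit (isGrading B Θ) := ⟨u, rfl⟩
  refine contMDiffAt_vec_of_coord (cellChart_mem_maximalAtlas B Θ)
    (w := coordField (isGrading B Θ) X) (param_mem_source B Θ _) ?_ ?_
  · rw [cellChart_param]
    exact contDiffAt_coordField (isGrading B Θ) X hP
  · rw [cellChart_param]
    filter_upwards [eventually_mem_affOrbit B Θ hP] with Q hQ
    exact invariantField_vec_param B Θ X Z hQ

lemma contDiffAt_formRep_invariantField {P : nMinus B Θ} (hP : P ∈ affOrbit (isGrading B Θ)) :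
    ContDiffAt ℝ ∞ (formRep (cellChart B Θ) (invariantField B Θ X Z).form) P := by
  let φ : nMinus B Θ →L[ℝ] ℝ :=
    LinearMap.toContinuousLinearMap (killingForm ℝ g (Z : g) ∘ₗ (nMinus B Θ).subtype)
  have h1 : ContDiffAt ℝ ∞ (fun Q => (φ.comp
      ((lieDEquiv (isGrading B Θ)).symm : nMinus B Θ →L[ℝ] nMinus B Θ)).comp
        (actN _ (isGrading B Θ) (orbitSection (isGrading B Θ) Q)⁻¹)) P :=
    contDiffAt_const.clm_comp (contDiffAt_actN_orbitSection (isGrading B Θ) hP).2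
  refine h1.congr_of_eventuallyEq ?_
  filter_upwards [eventually_mem_affOrbit B Θ hP] with Q hQ
  ext w
  exact invariantField_form_param B Θ X Z hQ w

lemma contMDiffAt_invariantField_form {q : FlagManifold B Θ} (hq : q ∈ openCell B Θ) :
    ContMDiffAt 𝓘(ℝ, nMinus B Θ) (𝓘(ℝ, nMinus B Θ).prod 𝓘(ℝ, nMinus B Θ →L[ℝ] ℝ)) ∞
      (fun x => (⟨x, (invariantField B Θ X Z).form x⟩ : Bundle.TotalSpace (nMinus B Θ →L[ℝ] ℝ)
        (fun x : FlagManifold B Θ => TangentSpace 𝓘(ℝ, nMinus B Θ) x →L[ℝ]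
          Bundle.Trivial (FlagManifold B Θ) ℝ x))) q := by
  obtain ⟨u, rfl⟩ := (mem_openCell_iff B Θ).1 hq
  refine contMDiffAt_form_of_formRep (cellChart_mem_maximalAtlas B Θ) (param_mem_source B Θ _) ?_
  rw [cellChart_param]
  exact contDiffAt_formRep_invariantField B Θ X Z ⟨u, rfl⟩

lemma invariantField_smoothOn : (invariantField B Θ X Z).SmoothOn (openCell B Θ) :=
  ⟨fun _ hq => (contMDiffAt_invariantField_vec B Θ X Z hq).contMDiffWithinAt,
    fun _ hq => (contMDiffAt_invariantField_form B Θ X Z hq).contMDiffWithinAt⟩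

lemma invariantField_vec_origin :
    (invariantField B Θ X Z).vec (origin B Θ) = tangentId B Θ X := by
  let V : FlagManifold B Θ → nMinus B Θ := (invariantField B Θ X Z).vec
  have h1 : V (param B Θ 0) = _ :=
    invariantField_vec_param B Θ X Z (zero_mem_affOrbit (isGrading B Θ))
  rw [coordField_zero, ← tangentId_apply, param_zero] at h1
  exact h1

/-- Invariant fields fill the tangent space at the origin, so the constant pairings determine the
form. -/
lemma invariantField_form_origin :
    (invariantField B Θ X Z).form (origin B Θ) = cotangentId B Θ (killingForm ℝ g (Z : g)) := by
  refine ContinuousLinearMap.ext fun w => ?_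
  obtain ⟨Y, rfl⟩ := (tangentId_bijective B Θ).2 w
  rw [cotangentId_tangentId, ← invariantField_vec_origin B Θ Y Z]
  exact invariantField_form_vec B Θ X Y Z Z (origin_mem_openCell B Θ)

lemma invariantField_vec_translate {u : Inn g} (hu : u ∈ NMinus B Θ) {q : FlagManifold B Θ}
    (hq : q ∈ openCell B Θ) :
    (invariantField B Θ X Z).vec (translate B Θ u q) =
      mfderiv 𝓘(ℝ, nMinus B Θ) 𝓘(ℝ, nMinus B Θ) (translate B Θ u) q
        ((invariantField B Θ X Z).vec q) := by
  obtain ⟨w, hw, rfl⟩ := hq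
  let V : FlagManifold B Θ → nMinus B Θ := (invariantField B Θ X Z).vec
  have h1 := invariantExt_vec B Θ (tangentId B Θ X) (cotangentId B Θ (killingForm ℝ g (Z : g))) hw
  have h2 := invariantExt_vec B Θ (tangentId B Θ X) (cotangentId B Θ (killingForm ℝ g (Z : g)))
    (mul_mem hu hw)
  have h3 : translate B Θ (u * w) = translate B Θ u ∘ translate B Θ w :=
    funext fun q => mul_smul u w q
  have h4 := mfderiv_comp (origin B Θ)
    (mdifferentiableAt_translate B Θ hu (q := translate B Θ w (origin B Θ)) ⟨w, hw, rfl⟩)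
    (mdifferentiableAt_translate B Θ hw (origin_mem_openCell B Θ))
  rw [h3, h4] at h2
  exact h2.trans (congrArg _ h1.symm)

/-- Every tangent vector at `q` is the value of an invariant field, and the pairing with that field
is the same constant at `q` and at its translate. -/
lemma invariantField_form_translate {u : Inn g} (hu : u ∈ NMinus B Θ) {q : FlagManifold B Θ}
    (hq : q ∈ openCell B Θ) :
    ((invariantField B Θ X Z).form (translate B Θ u q)).comp
      (mfderiv 𝓘(ℝ, nMinus B Θ) 𝓘(ℝ, nMinus B Θ) (translate B Θ u) q) =
        (invariantField B Θ X Z).form q := by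
  have huq : translate B Θ u q ∈ openCell B Θ := by
    obtain ⟨w, hw, rfl⟩ := hq
    exact ⟨u * w, mul_mem hu hw, mul_smul u w _⟩
  refine ContinuousLinearMap.ext fun t => ?_
  obtain ⟨Y, hY⟩ : ∃ Y, (invariantField B Θ Y Z).vec q = t := by
    obtain ⟨w, rfl⟩ := (mem_openCell_iff B Θ).1 hq
    obtain ⟨t', rfl⟩ := (dparam B Θ _).surjective t
    -- This solves `w [Y, D] = t'` for `Y`.
    refine ⟨(lieDEquiv (isGrading B Θ)).symm (actN _ (isGrading B Θ) w⁻¹ t'), ?_⟩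
    refine (invariantField_vec_param B Θ _ Z (aff_mem_affOrbit B Θ w)).trans ?_
    rw [coordField, orbitSection_aff, ContinuousLinearEquiv.apply_symm_apply, ← actN_mul,
      mul_inv_cancel, actN_one]
  rw [← hY, invariantField_form_vec B Θ X Y Z Z hq, ← invariantField_form_vec B Θ X Y Z Z huq,
    invariantField_vec_translate B Θ Y Z hu hq]
  rfl

/-! ### The Courant bracket and the Nijenhuis operator at the origin. -/

lemma mlieBracket_invariantField :
    VectorField.mlieBracket 𝓘(ℝ, nMinus B Θ) (invariantField B Θ X Z).vec
      (invariantField B Θ Y W).vec (origin B Θ) = tangentId B Θ (bracketMinus B Θ X Y) := by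
  have hmd : ∀ (X : nMinus B Θ) (Z : nPlus B Θ), MDifferentiableAt 𝓘(ℝ, nMinus B Θ)
      (𝓘(ℝ, nMinus B Θ).prod 𝓘(ℝ, nMinus B Θ)) (fun x => (⟨x, (invariantField B Θ X Z).vec x⟩ :
        TangentBundle 𝓘(ℝ, nMinus B Θ) (FlagManifold B Θ))) (param B Θ 0) := fun X Z => by
    rw [param_zero]
    exact (contMDiffAt_invariantField_vec B Θ X Z (origin_mem_openCell B Θ)).mdifferentiableAt
      (by simp)
  have : IsManifold 𝓘(ℝ, nMinus B Θ) (minSmoothness ℝ 2) (FlagManifold B Θ) := by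
    rw [minSmoothness_of_isRCLikeNormedField]; infer_instance
  -- Naturality of the Lie bracket under pullback by `param` reduces the computation to
  -- `lieBracket_coordField`.
  have h1 := VectorField.mpullback_mlieBracket (I := 𝓘(ℝ, nMinus B Θ)) (n := ∞)
    (hmd X Z) (hmd Y W) (contMDiff_param B Θ 0)
    (by rw [minSmoothness_of_isRCLikeNormedField]; exact ENat.LEInfty.out)
  -- The coordinate formula holds on the orbit, a neighbourhood of 0; the bracket depends only on
  -- germs.
  have h2 : ∀ (X : nMinus B Θ) (Z : nPlus B Θ), VectorField.mpullback 𝓘(ℝ, nMinus B Θ)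
      𝓘(ℝ, nMinus B Θ) (param B Θ) (invariantField B Θ X Z).vec =ᶠ[𝓝 0]
        coordField (isGrading B Θ) X := fun X Z => by
    filter_upwards [eventually_mem_affOrbit B Θ (zero_mem_affOrbit (isGrading B Θ))] with P hP
    exact (mpullback_symm_eq_iff (cellChart_mem_maximalAtlas B Θ) (mem_cellChart_target B Θ P)).2
      (invariantField_vec_param B Θ X Z hP)
  have h1' := h1.trans (((h2 X Z).mlieBracket_vectorField_eq (h2 Y W)).trans
    ((congrFun (mlieBracket_eq_lieBracket (coordField (isGrading B Θ) X) _) 0).trans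
      (lieBracket_coordField (isGrading B Θ) X Y)))
  let V : FlagManifold B Θ → nMinus B Θ := VectorField.mlieBracket 𝓘(ℝ, nMinus B Θ)
    (invariantField B Θ X Z).vec (invariantField B Θ Y W).vec
  have h4 : V (param B Θ 0) = dparam B Θ 0 (lieDEquiv (isGrading B Θ) (bracketMinus B Θ X Y)) :=
    (mpullback_symm_eq_iff (cellChart_mem_maximalAtlas B Θ) (mem_cellChart_target B Θ 0)).1 h1'
  have h5 := h4.trans (tangentId_apply B Θ (bracketMinus B Θ X Y)).symm
  rw [param_zero] at h5
  exact h5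

/-- The test vector is extended to the invariant field of `C`. Its pairing with the form is
constant, so only the bracket term of Cartan's formula survives. -/
lemma lieDerivForm_invariantField (C : nMinus B Θ) :
    lieDerivForm (invariantField B Θ X Z).vec (invariantField B Θ Y W).form (origin B Θ)
      (tangentId B Θ C) = -killingForm ℝ g (W : g) ⁅(X : g), (C : g)⁆ := by
  have ho := origin_mem_openCell B Θ
  -- `lieDerivForm` uses the preferred chart at the origin, while smoothness is known in
  -- `cellChart`; a change of chart connects them.
  have hη : DifferentiableAt ℝ (formRep (chartAt (nMinus B Θ) (origin B Θ))
      (invariantField B Θ Y W).form) (chartAt (nMinus B Θ) (origin B Θ) (origin B Θ)) := by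
    refine (contDiffAt_formRep_of_chart (IsManifold.chart_mem_maximalAtlas _)
      (cellChart_mem_maximalAtlas B Θ) (mem_chart_source _ _) (openCell_subset_source B Θ ho)
      ?_).differentiableAt (by simp)
    rw [← param_zero, cellChart_param]
    exact contDiffAt_formRep_invariantField B Θ Y W (zero_mem_affOrbit (isGrading B Θ))
  have hc : ∀ᶠ q in 𝓝 (origin B Θ), (invariantField B Θ Y W).form q
      ((invariantField B Θ C Z).vec q) = killingForm ℝ g (W : g) (C : g) := by
    filter_upwards [(isOpen_openCell B Θ).mem_nhds ho] with q hq
    exact invariantField_form_vec B Θ Y C W Z hq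
  have h1 := lieDerivForm_apply_of_const
    ((contMDiffAt_invariantField_vec B Θ X Z ho).mdifferentiableAt (by simp))
    ((contMDiffAt_invariantField_vec B Θ C Z ho).mdifferentiableAt (by simp)) hη hc
  rw [invariantField_vec_origin, mlieBracket_invariantField, invariantField_form_origin,
    cotangentId_tangentId] at h1
  exact h1

lemma courant_invariantField_vec :
    (GenField.courant (invariantField B Θ X Z) (invariantField B Θ Y W)).vec (origin B Θ) =
      tangentId B Θ (bracketMinus B Θ X Y) :=
  mlieBracket_invariantField B Θ X Y Z W

/-- The bracket on the right is the coadjoint action on the dual of the whole algebra; `cotangentId`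
restricts it to `nMinus B Θ`, which is closed under the bracket. -/
lemma courant_invariantField_form :
    (GenField.courant (invariantField B Θ X Z) (invariantField B Θ Y W)).form (origin B Θ) =
      cotangentId B Θ (⁅(X : g), (killingForm ℝ g (W : g) : Module.Dual ℝ g)⁆ -
        ⁅(Y : g), (killingForm ℝ g (Z : g) : Module.Dual ℝ g)⁆) := by
  refine ContinuousLinearMap.ext fun w => ?_
  obtain ⟨C, rfl⟩ := (tangentId_bijective B Θ).2 w
  -- Both contractions are constant on the cell, so their difference has zero differential at the
  -- origin.
  have hd : dFun (E := nMinus B Θ) (fun q => (invariantField B Θ Y W).form q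
      ((invariantField B Θ X Z).vec q) - (invariantField B Θ X Z).form q
        ((invariantField B Θ Y W).vec q)) (origin B Θ) = 0 := by
    have h1 : (fun q => (invariantField B Θ Y W).form q
      ((invariantField B Θ X Z).vec q) - (invariantField B Θ X Z).form q
        ((invariantField B Θ Y W).vec q)) =ᶠ[𝓝 (origin B Θ)] fun _ =>
          killingForm ℝ g (W : g) (X : g) - killingForm ℝ g (Z : g) (Y : g) := by
      filter_upwards [(isOpen_openCell B Θ).mem_nhds (origin_mem_openCell B Θ)] with q hq
      rw [invariantField_form_vec B Θ Y X W Z hq, invariantField_form_vec B Θ X Y Z W hq]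
    unfold dFun
    rw [h1.mfderiv_eq, mfderiv_const]
    rfl
  have h2 : (GenField.courant (invariantField B Θ X Z) (invariantField B Θ Y W)).form (origin B Θ)
      (tangentId B Θ C) =
      lieDerivForm (invariantField B Θ X Z).vec (invariantField B Θ Y W).form (origin B Θ)
        (tangentId B Θ C) -
      lieDerivForm (invariantField B Θ Y W).vec (invariantField B Θ X Z).form (origin B Θ)
        (tangentId B Θ C) := by
    simp only [GenField.courant]
    rw [hd, smul_zero, sub_zero]
    rfl
  rw [h2, lieDerivForm_invariantField, lieDerivForm_invariantField, cotangentId_tangentId]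
  simp

lemma nij_invariantField (A₁ B₁ C₁ : nMinus B Θ) (A₂ B₂ C₂ : nPlus B Θ) :
    GenField.nij (invariantField B Θ A₁ A₂) (invariantField B Θ B₁ B₂)
      (invariantField B Θ C₁ C₂) (origin B Θ) =
    (1 / 2 : ℝ) * (killingForm ℝ g (A₂ : g) ⁅(B₁ : g), (C₁ : g)⁆ +
      killingForm ℝ g (B₂ : g) ⁅(C₁ : g), (A₁ : g)⁆ +
      killingForm ℝ g (C₂ : g) ⁅(A₁ : g), (B₁ : g)⁆) := by
  have key : ∀ (A₁ B₁ C₁ : nMinus B Θ) (A₂ B₂ C₂ : nPlus B Θ),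
      GenField.pair (GenField.courant (invariantField B Θ A₁ A₂) (invariantField B Θ B₁ B₂))
        (invariantField B Θ C₁ C₂) (origin B Θ) =
      (1 / 2 : ℝ) * (killingForm ℝ g (A₂ : g) ⁅(B₁ : g), (C₁ : g)⁆ +
        killingForm ℝ g (B₂ : g) ⁅(C₁ : g), (A₁ : g)⁆ +
        killingForm ℝ g (C₂ : g) ⁅(A₁ : g), (B₁ : g)⁆) := fun A₁ B₁ C₁ A₂ B₂ C₂ => by
    unfold GenField.pair
    rw [courant_invariantField_form, courant_invariantField_vec, invariantField_vec_origin,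
      invariantField_form_origin, cotangentId_tangentId, cotangentId_tangentId]
    have h1 : ⁅(C₁ : g), (A₁ : g)⁆ = -⁅(A₁ : g), (C₁ : g)⁆ := (lie_skew _ _).symm
    rw [h1]
    simp only [LinearMap.sub_apply, Module.Dual.lie_apply, map_neg, bracketMinus]
    ring
  unfold GenField.nij
  -- Each use gives the same sum up to a cyclic permutation, so the total is three times one term.
  rw [key, key, key]
  ring

/-! ### Duality of `nPlus` and `nMinus` under the Killing form. -/

lemma nPlus_le : nPlus B Θ ≤ ⨆ k : ℕ, eig (gradingElement B Θ : g) ((k : ℝ) + 1) := by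
  refine iSup₂_le fun α hα => ?_
  obtain ⟨k, hk, hk'⟩ := closure_apply B Θ (root_mem_closure B hα.1)
  -- A positive root of degree 0 would be generated by `Θ`.
  obtain ⟨l, rfl⟩ := Nat.exists_eq_succ_of_ne_zero fun h => hα.2 (hk' h)
  push_cast at hk
  exact (rootSpace_le_eig B Θ hk).trans
    (le_iSup (fun k : ℕ => eig (gradingElement B Θ : g) ((k : ℝ) + 1)) l)

lemma nPlus_sup : nPlus B Θ ⊔ ⨆ k : ℕ, eig (gradingElement B Θ : g) (-(k : ℝ)) = ⊤ := by
  have h1 : (⨆ χ : LieModule.Weight ℝ H g, (rootSpace H χ).toSubmodule) = ⊤ := by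
    rw [← LieSubmodule.iSup_toSubmodule, LieModule.iSup_genWeightSpace_eq_top' ℝ H g]
    rfl
  rw [eq_top_iff, ← h1]
  refine iSup_le fun χ => ?_
  by_cases hχ : χ.IsZero
  · refine le_sup_of_le_right (le_trans ?_
      (le_iSup (fun k : ℕ => eig (gradingElement B Θ : g) (-(k : ℝ))) 0))
    have : (χ : H → ℝ) = 0 := hχ
    rw [this]
    intro x hx
    rw [LieSubmodule.mem_toSubmodule, ← LieSubmodule.mem_toSubmodule,
      LieAlgebra.rootSpace_zero_eq ℝ g H] at hx
    rw [mem_eig]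
    have : ⁅gradingElement B Θ, (⟨x, hx⟩ : H)⁆ = 0 := trivial_lie_zero _ _ _ _
    simpa using congrArg Subtype.val this
  · have hr : χ ∈ H.root := by simpa using hχ
    by_cases hg : GeneratedBy B Θ ⟨χ, hr⟩
    · refine le_sup_of_le_right (le_iSup_of_le 0 ?_)
      exact rootSpace_le_eig B Θ (α := ⟨χ, hr⟩) (by simpa using generatedBy_apply B Θ hg)
    by_cases hp : B.IsPos ⟨χ, hr⟩
    · exact le_sup_of_le_left (le_iSup₂_of_le (⟨χ, hr⟩ : H.root) ⟨hp, hg⟩ le_rfl)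
    · obtain ⟨k, hk, -⟩ := closure_apply B Θ (neg_root_mem_closure B hp)
      refine le_sup_of_le_right (le_iSup_of_le k ?_)
      exact rootSpace_le_eig B Θ (α := ⟨χ, hr⟩) (by rw [← hk, LinearMap.neg_apply, neg_neg])

lemma killingForm_nPlus_pTheta {x y : g} (hx : x ∈ nPlus B Θ) (hy : y ∈ pTheta B Θ) :
    killingForm ℝ g x y = 0 :=
  killingForm_iSup_eig (nPlus_le B Θ hx) ((isGrading B Θ).p_le hy) fun i k => by positivity

/-- The Killing form identifies `n_Θ⁺` with the dual of `n_Θ⁻`. -/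
lemma cotangentId_bijective :
    Function.Bijective (fun Z : nPlus B Θ => cotangentId B Θ (killingForm ℝ g (Z : g))) := by
  have htop : ∀ y : g, ∃ a ∈ pTheta B Θ, ∃ b ∈ nMinus B Θ, a + b = y := fun y =>
    Submodule.mem_sup.1 ((isGrading B Θ).top ▸ Submodule.mem_top)
  constructor
  · intro Z W hZW
    apply Subtype.ext
    rw [← sub_eq_zero]
    -- The difference is orthogonal to `pTheta` by degrees and to `nMinus` by hypothesis, hence to
    -- everything.
    apply eq_zero_of_killingForm
    intro y
    obtain ⟨a, ha, b, hb, rfl⟩ := htop y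
    have h1 := congrArg (fun L => L (tangentId B Θ ⟨b, hb⟩)) hZW
    simp only [cotangentId_tangentId] at h1
    rw [map_add, killingForm_nPlus_pTheta B Θ (sub_mem Z.2 W.2) ha, zero_add, map_sub,
      LinearMap.sub_apply, h1, sub_self]
  · intro ξ
    let π : g →ₗ[ℝ] nMinus B Θ := (nMinus B Θ).projectionOnto _ (isGrading B Θ).isCompl.symm
    -- The covector is extended by zero on `pTheta`; nondegeneracy then represents the extension by
    -- some `z`.
    let φ : Module.Dual ℝ g :=
      (ξ.comp (tangentEquiv B Θ : nMinus B Θ →L[ℝ] _) : nMinus B Θ →ₗ[ℝ] ℝ) ∘ₗ π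
    have hsurj : Function.Surjective (killingForm ℝ g) := by
      refine (LinearMap.injective_iff_surjective_of_finrank_eq_finrank
        (Subspace.dual_finrank_eq (K := ℝ) (V := g)).symm).1 ?_
      rw [← LinearMap.ker_eq_bot]
      exact LieAlgebra.IsKilling.ker_killingForm_eq_bot ℝ g
    obtain ⟨z, hz⟩ := hsurj φ
    have hzp : ∀ a ∈ pTheta B Θ, killingForm ℝ g z a = 0 := fun a ha => by
      rw [hz]
      have : π a = 0 := Submodule.projectionOnto_apply_right (isGrading B Θ).isCompl.symm ⟨a, ha⟩
      simp [φ, this]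
    obtain ⟨s, hs, r, hr, rfl⟩ := Submodule.mem_sup.1
      ((nPlus_sup B Θ).symm ▸ Submodule.mem_top : z ∈ _)
    -- The part `r` of degree at most 0 is orthogonal to `pTheta`, as `z` and `s` are, and to
    -- `nMinus` because the degrees add to a negative number. So `z` lies in `nPlus`.
    have hr0 : r = 0 := by
      apply eq_zero_of_killingForm
      intro y
      obtain ⟨a, ha, b, hb, rfl⟩ := htop y
      have h1 := hzp a ha
      rw [map_add, LinearMap.add_apply, killingForm_nPlus_pTheta B Θ hs ha, zero_add] at h1
      rw [map_add, h1, zero_add]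
      refine killingForm_iSup_eig hr ((isGrading B Θ).n_le hb) fun i k => ?_
      have h2 : (0 : ℝ) ≤ i := i.cast_nonneg
      have h3 : (0 : ℝ) ≤ k := k.cast_nonneg
      intro h4
      linarith
    refine ⟨⟨s, hs⟩, ContinuousLinearMap.ext fun w => ?_⟩
    obtain ⟨C, rfl⟩ := (tangentId_bijective B Θ).2 w
    simp only [cotangentId_tangentId]
    rw [hr0, add_zero] at hz
    have : π C = C := Submodule.projectionOnto_apply_left (isGrading B Θ).isCompl.symm C
    rw [hz, tangentId_eq]
    simp [φ, this]

end FlagManifold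

end Flag

end

end RealFlag

theorem proposition3 {g : Type*} [LieRing g] [LieAlgebra ℝ g] [FiniteDimensional ℝ g]
    [LieAlgebra.IsKilling ℝ g] {H : LieSubalgebra ℝ g} [H.IsCartanSubalgebra]
    [LieModule.IsTriangularizable ℝ H g]
    (B : (LieAlgebra.IsKilling.rootSystem H).Base) (Θ : Set B.support) :
    -- the tangent and the cotangent space at the origin are `n_Θ⁻` and `n_Θ⁺`
    Function.Bijective (tangentId B Θ) ∧
    Function.Bijective (fun Z : nPlus B Θ => cotangentId B Θ (killingForm ℝ g (Z : g))) ∧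
    -- the sections `X + Z*` are smooth and invariant on an open neighbourhood of the origin
    IsOpen (openCell B Θ) ∧ origin B Θ ∈ openCell B Θ ∧
    (∀ (X : nMinus B Θ) (Z : nPlus B Θ),
      (invariantField B Θ X Z).SmoothOn (openCell B Θ) ∧
      (invariantField B Θ X Z).vec (origin B Θ) = tangentId B Θ X ∧
      (invariantField B Θ X Z).form (origin B Θ) = cotangentId B Θ (killingForm ℝ g (Z : g)) ∧
      ∀ u ∈ NMinus B Θ, ∀ q ∈ openCell B Θ,
        (invariantField B Θ X Z).vec (translate B Θ u q) =
          mfderiv 𝓘(ℝ, nMinus B Θ) 𝓘(ℝ, nMinus B Θ) (translate B Θ u) q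
            ((invariantField B Θ X Z).vec q) ∧
        ((invariantField B Θ X Z).form (translate B Θ u q)).comp
          (mfderiv 𝓘(ℝ, nMinus B Θ) 𝓘(ℝ, nMinus B Θ) (translate B Θ u) q) =
            (invariantField B Θ X Z).form q) ∧
    -- the Courant bracket at the origin
    (∀ (X Y : nMinus B Θ) (Z W : nPlus B Θ),
      (GenField.courant (invariantField B Θ X Z) (invariantField B Θ Y W)).vec (origin B Θ) =
        tangentId B Θ (bracketMinus B Θ X Y) ∧
      (GenField.courant (invariantField B Θ X Z) (invariantField B Θ Y W)).form (origin B Θ) =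
        cotangentId B Θ (⁅(X : g), (killingForm ℝ g (W : g) : Module.Dual ℝ g)⁆ -
          ⁅(Y : g), (killingForm ℝ g (Z : g) : Module.Dual ℝ g)⁆)) ∧
    -- the Nijenhuis operator at the origin
    (∀ (A₁ B₁ C₁ : nMinus B Θ) (A₂ B₂ C₂ : nPlus B Θ),
      GenField.nij (invariantField B Θ A₁ A₂) (invariantField B Θ B₁ B₂)
          (invariantField B Θ C₁ C₂) (origin B Θ) =
        (1 / 2 : ℝ) * (killingForm ℝ g (A₂ : g) ⁅(B₁ : g), (C₁ : g)⁆ +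
          killingForm ℝ g (B₂ : g) ⁅(C₁ : g), (A₁ : g)⁆ +
          killingForm ℝ g (C₂ : g) ⁅(A₁ : g), (B₁ : g)⁆)) := by
  exact ⟨tangentId_bijective B Θ, cotangentId_bijective B Θ, isOpen_openCell B Θ,
    origin_mem_openCell B Θ,
    fun X Z => ⟨invariantField_smoothOn B Θ X Z, invariantField_vec_origin B Θ X Z,
      invariantField_form_origin B Θ X Z, fun u hu q hq =>
        ⟨invariantField_vec_translate B Θ X Z hu hq, invariantField_form_translate B Θ X Z hu hq⟩⟩,
    fun X Y Z W => ⟨courant_invariantField_vec B Θ X Y Z W, courant_invariantField_form B Θ X Y Z W⟩,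
    fun A₁ B₁ C₁ A₂ B₂ C₂ => nij_invariantField B Θ A₁ B₁ C₁ A₂ B₂ C₂⟩
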